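/- In the secretary problem with predictions there are $n\ge 1$ candidates with pairwise distinct true values $v_i\ge 0$ and predicted values $\hat v_i\ge 0$, the latter known in advance. Let $v^*=\max_i v_i$, let $\hat\imath$ be a candidate of highest predicted value, and let $\epsilon=\max_i\operatorname{err}_i$, where $\operatorname{err}_i=|1-\hat v_i/v_i|$ is the multiplicative prediction error of candidate $i$ (if $v_i=0$, put $\operatorname{err}_i=0$ when $\hat v_i=0$ and $\operatorname{err}_i=1$ otherwise). Chosen order: the decision-maker lets $\hat\imath$ arrive at the fixed time $t_{\hat\imath}=\beta=0.64$; all other candidates $i$ arrive at independent times $t_i$ uniform on $[0,1]$. The value $v_i$ is revealed at time $t_i$, and the candidate must then be irrevocably hired or rejected. The following algorithm is run with $\theta=0.58$, $\tau=0.37$, $\gamma=0.27$, $\delta=0.46$. It starts in Prediction mode and processes the candidates in increasing order of arrival time. When candidate $i$ arrives: 1. If the mode is Prediction and $\operatorname{err}_i>\theta$, the mode becomes Secretary (for good), and $t_M:=t_i$. 2. If the mode is now Prediction and $i=\hat\imath$, candidate $i$ is hired and the algorithm stops. 3. If the mode is now Secretary, $t_i>\tau$, and $v_i>v_j$ for all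 $j$ with $t_j<t_i$, then: if $i=\hat\imath$ and $t_i=t_M$, candidate $i$ is hired with probability $\gamma$; if $i=\hat\imath$ and $t_i\neq t_M$, it is hired with probability $\delta$; if $i\ne\hat\imath$, it is hired. If a candidate is hired, the algorithm stops. The reward is the true value of the hired candidate, and $0$ if nobody is hired. **Theorem 1.** The algorithm is at least $\max\{0.262,\frac{1-\epsilon}{1+\epsilon}\}$-competitive: for every such instance, its expected reward, over the arrival times and the internal randomness of the algorithm, is at least $$\max\Big\{0.262,\ \frac{1-\epsilon}{1+\epsilon}\Big\}\cdot v^*.$$ -/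

import Mathlib

open MeasureTheory

namespace COSP

/-- The multiplicative prediction error `|1 - vhat / v|` of a prediction `vhat` for the value `v`.
For a candidate of value zero the quotient is undefined; then the error is `0` if the prediction is
exact and `1` otherwise. -/
noncomputable def predError (v vhat : ℝ) : ℝ :=
  if v = 0 then (if vhat = 0 then 0 else 1) else |1 - vhat / v|

/-- The largest multiplicative prediction error among all candidates. -/
noncomputable def maxError {n : ℕ} (v vhat : Fin n → ℝ) : ℝ :=
  ⨆ i, predError (v i) (vhat i)

/-- The highest true value among all candidates. -/
noncomputable def bestValue {n : ℕ} (v : Fin n → ℝ) : ℝ :=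
  ⨆ i, v i

/-- The mode of the algorithm; in Secretary mode it remembers the time `tM` of the switch. -/
inductive Mode where
  | prediction : Mode
  | secretary (tM : ℝ) : Mode

/-- The parameters of the algorithm: the error threshold `θ`, the time threshold `τ`, and the two
probabilities `γ`, `δ` of hiring the top predicted candidate in Secretary mode. -/
structure Params where
  θ : ℝ
  τ : ℝ
  γ : ℝ
  δ : ℝ

open Classical in
/-- The mode after candidate `i` has been observed: the first observed candidate whose prediction
error exceeds `θ` switches the mode from Prediction to Secretary. -/
noncomputable def nextMode {n : ℕ} (P : Params) (v vhat : Fin n → ℝ) (t : Fin n → ℝ)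
    (i : Fin n) : Mode → Mode
  | Mode.prediction =>
      if P.θ < predError (v i) (vhat i) then Mode.secretary (t i) else Mode.prediction
  | Mode.secretary tM => Mode.secretary tM

open Classical in
/-- Whether candidate `i` is hired on arrival, the mode having been updated already.
The number `u` is a uniform random seed in `[0, 1]`: `u < p` realizes "with probability `p`". One
seed is enough, because the top predicted candidate `top` arrives only once. -/
noncomputable def hires {n : ℕ} (P : Params) (v : Fin n → ℝ) (top : Fin n)
    (t : Fin n → ℝ) (u : ℝ) (i : Fin n) : Mode → Prop
  | Mode.prediction => i = top
  | Mode.secretary tM =>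
      P.τ < t i ∧ (∀ j, t j < t i → v j < v i) ∧
        (if i = top ∧ t i = tM then u < P.γ else if i = top then u < P.δ else True)

open Classical in
/-- The main loop: process the candidates in the given list one after the other; the output is the
hired candidate, if any. -/
noncomputable def loop {n : ℕ} (P : Params) (v vhat : Fin n → ℝ) (top : Fin n)
    (t : Fin n → ℝ) (u : ℝ) : Mode → List (Fin n) → Option (Fin n)
  | _, [] => none
  | mode, i :: rest =>
      if hires P v top t u i (nextMode P v vhat t i mode) then some i
      else loop P v vhat top t u (nextMode P v vhat t i mode) rest

/-- The candidate hired by the algorithm for arrival times `t` and random seed `u`. It starts in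
Prediction mode and processes the candidates in increasing order of arrival time. -/
noncomputable def run {n : ℕ} (P : Params) (v vhat : Fin n → ℝ) (top : Fin n)
    (t : Fin n → ℝ) (u : ℝ) : Option (Fin n) :=
  loop P v vhat top t u Mode.prediction (List.ofFn (Tuple.sort t))

/-- The reward of an outcome: the true value of the hired candidate, and `0` if nobody is hired. -/
def reward {n : ℕ} (v : Fin n → ℝ) : Option (Fin n) → ℝ
  | none => 0
  | some i => v i

/-- The uniform distribution on the unit interval. -/
noncomputable def unif : Measure ℝ := volume.restrict (Set.Icc 0 1)

open Classical in
/-- The law of the arrival times: candidate `top` arrives at the fixed time `β`, the other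
candidates arrive independently and uniformly at random in the unit interval. -/
noncomputable def arrivalLaw {n : ℕ} (top : Fin n) (β : ℝ) : Measure (Fin n → ℝ) :=
  Measure.pi fun i => if i = top then Measure.dirac β else unif

/-- The expected reward, over the arrival times and the independent random seed. -/
noncomputable def expectedReward {n : ℕ} (P : Params) (β : ℝ) (v vhat : Fin n → ℝ)
    (top : Fin n) : ℝ :=
  ∫ ω : (Fin n → ℝ) × ℝ, reward v (run P v vhat top ω.1 ω.2) ∂((arrivalLaw top β).prod unif)

end COSP

/-! Let `i` be the best candidate and call a candidate bad if its error exceeds 0.58. If nobody is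
bad, `top` is hired, and comparing predictions gives its value the factor (1-ε)/(1+ε), which is at
least 42/158 > 0.262 (`ratio_mul_le`). Otherwise ε > 0.58, so the target factor ρ is at most 42/158
< 0.2659.

Let k count the bad candidates other than `i` and `top`. With probability 0.36^k all of them arrive
after 0.64 (late runs). The other runs are treated as in the secretary problem: the best arrival
until time b comes before a with probability at least a/b, and requiring also a bad arrival until b
costs only the factor 1-(1-b)^k (`le_measureReal_noRecord`; `le_bestEarly_add_allAfter` is the
general form). For `i ≠ top` these runs contribute at least 0.268 (1-0.36^k) v*
(`le_expectedReward_of_rewardIfLate`); for `i = top` the factor is 0.46·0.37/0.64 > 0.2659.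

It remains to gain enough in late runs. If `i = top`, it is hired with probability at least 0.27. If
`i` is bad, it triggers the switch itself and is hired when arriving in (0.37, 0.64). If `i` and
`top` are good, `top` is hired. If only `top` is bad and it is second best, an `i` arriving after
0.64 wins once `top` is rejected, and 0.73·0.36 = 0.2628. If instead some other candidate beats
`top`, the best such blocker keeps `top` from being hired when it comes early; this case counts its
runs directly, according to k (`le_expectedReward_of_blocker`). -/

namespace COSP

/-! ### Resampling one coordinate of a product measure -/

section Product

variable {ι : Type*} [Fintype ι] [DecidableEq ι] (μ : ι → Measure ℝ)
  [∀ i, IsProbabilityMeasure (μ i)]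

/-- Resampling one coordinate of a product probability measure does not change it. -/
theorem measurePreserving_update_pi (i : ι) :
    MeasurePreserving (fun p : ℝ × (ι → ℝ) => Function.update p.2 i p.1)
      ((μ i).prod (Measure.pi μ)) (Measure.pi μ) := by
  have hm : Measurable (fun p : ℝ × (ι → ℝ) => Function.update p.2 i p.1) := by
    rw [measurable_pi_iff]
    intro j
    by_cases h : j = i
    · subst h; simpa using measurable_fst
    · simp only [Function.update_of_ne h]
      exact (measurable_pi_apply j).comp measurable_snd
  refine ⟨hm, ?_⟩
  symm
  apply Measure.pi_eq
  intro s hs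
  rw [Measure.map_apply hm (MeasurableSet.univ_pi hs)]
  have : (fun p : ℝ × (ι → ℝ) => Function.update p.2 i p.1) ⁻¹' Set.univ.pi s =
      s i ×ˢ Set.univ.pi (Function.update s i Set.univ) := by
    ext ⟨t, x⟩
    simp only [Set.mem_preimage, Set.mem_pi, Set.mem_univ, true_imp_iff, Set.mem_prod]
    constructor
    · intro h
      refine ⟨by simpa using h i, fun j => ?_⟩
      by_cases hj : j = i
      · subst hj; simp
      · simpa [Function.update_of_ne hj] using h j
    · rintro ⟨h1, h2⟩ j
      by_cases hj : j = i
      · subst hj; simpa using h1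
      · simpa [Function.update_of_ne hj] using h2 j
  rw [this, Measure.prod_prod, Measure.pi_pi, ← Finset.mul_prod_erase Finset.univ _
    (Finset.mem_univ i), ← Finset.mul_prod_erase Finset.univ (fun j => μ j (s j))
    (Finset.mem_univ i)]
  simp only [Function.update_self, measure_univ, one_mul]
  congr 1
  refine Finset.prod_congr rfl fun j hj => ?_
  rw [Function.update_of_ne (Finset.ne_of_mem_erase hj)]

/-- This conditions on one arrival time while staying on the full product space: coordinate `i` of
`x` is overwritten and thus ignored. -/
theorem integral_pi_update (i : ι) {F : (ι → ℝ) → ℝ} (hF : Integrable F (Measure.pi μ)) :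
    ∫ x, F x ∂Measure.pi μ = ∫ t, ∫ x, F (Function.update x i t) ∂Measure.pi μ ∂μ i := by
  have h := measurePreserving_update_pi μ i
  have h2 := integral_map h.measurable.aemeasurable (f := F) (by
    rw [h.map_eq]; exact hF.aestronglyMeasurable)
  rw [h.map_eq] at h2
  rw [h2]
  exact (integral_prod (fun p : ℝ × (ι → ℝ) => F (Function.update p.2 i p.1))
    (h.integrable_comp_of_integrable hF))

/-- An event about one coordinate is independent of an event about the other coordinates. -/
theorem measureReal_coord_inter (i : ι) {I : Set ℝ} (hI : MeasurableSet I) {Q : Set (ι → ℝ)}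
    (hQ : MeasurableSet Q) (hdep : ∀ x t, Function.update x i t ∈ Q ↔ x ∈ Q) :
    (Measure.pi μ).real ({x | x i ∈ I} ∩ Q) = (μ i).real I * (Measure.pi μ).real Q := by
  have h := measurePreserving_update_pi μ i
  have hI' : MeasurableSet {x : ι → ℝ | x i ∈ I} := measurable_pi_apply i hI
  rw [measureReal_def, ← h.measure_preimage (hI'.inter hQ).nullMeasurableSet]
  have : (fun p : ℝ × (ι → ℝ) => Function.update p.2 i p.1) ⁻¹' ({x | x i ∈ I} ∩ Q) =
      I ×ˢ Q := by
    ext ⟨t, x⟩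
    simp [hdep]
  rw [this, Measure.prod_prod, ENNReal.toReal_mul]
  rfl

end Product

instance : IsProbabilityMeasure unif := ⟨by simp [unif]⟩

instance : NullSingletonClass unif := by unfold unif; infer_instance

theorem unif_real_Iio {a : ℝ} (h0 : 0 ≤ a) (h1 : a ≤ 1) : unif.real (Set.Iio a) = a := by
  have : Set.Iio a ∩ Set.Icc 0 1 = Set.Ico 0 a := by
    ext y; simp only [Set.mem_inter_iff, Set.mem_Iio, Set.mem_Icc, Set.mem_Ico]
    constructor
    · rintro ⟨h, h', _⟩; exact ⟨h', h⟩
    · rintro ⟨h, h'⟩; exact ⟨h', h, by linarith⟩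
  rw [unif, measureReal_restrict_apply measurableSet_Iio, this]
  simp [h0]

theorem unif_real_Ioi {a : ℝ} (h0 : 0 ≤ a) (h1 : a ≤ 1) : unif.real (Set.Ioi a) = 1 - a := by
  have : Set.Ioi a ∩ Set.Icc 0 1 = Set.Ioc a 1 := by
    ext y; simp only [Set.mem_inter_iff, Set.mem_Ioi, Set.mem_Icc, Set.mem_Ioc]
    constructor
    · rintro ⟨h, h', h2⟩; exact ⟨h, h2⟩
    · rintro ⟨h, h'⟩; exact ⟨h, by linarith, h'⟩
  rw [unif, measureReal_restrict_apply measurableSet_Ioi, this]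
  simp [h1]

theorem unif_real_Ioo {a b : ℝ} (h0 : 0 ≤ a) (hab : a ≤ b) (h1 : b ≤ 1) :
    unif.real (Set.Ioo a b) = b - a := by
  have : Set.Ioo a b ∩ Set.Icc 0 1 = Set.Ioo a b := by
    ext y; simp only [Set.mem_inter_iff, Set.mem_Icc, Set.mem_Ioo]
    constructor
    · rintro ⟨h, h'⟩; exact h
    · rintro ⟨h, h'⟩; exact ⟨⟨h, h'⟩, by linarith, by linarith⟩
  rw [unif, measureReal_restrict_apply measurableSet_Ioo, this]
  simp [hab]

/-! ### Records among uniform arrival times -/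

section Records

variable {ι : Type*} [Fintype ι] [DecidableEq ι]

/-- Some candidate of `s` with property `bad` arrives before time `b`. -/
def badBefore (bad : ι → Prop) (s : Finset ι) (b : ℝ) : Set (ι → ℝ) :=
  {x | ∃ j ∈ s, bad j ∧ x j < b}

/-- All candidates of `s` arrive after time `b`. -/
def allAfter (s : Finset ι) (b : ℝ) : Set (ι → ℝ) := {x | ∀ j ∈ s, b < x j}

/-- The best candidate of `s` among those arriving until time `b` exists and arrives before
time `a`. -/
def bestEarly (v : ι → ℝ) (s : Finset ι) (a b : ℝ) : Set (ι → ℝ) :=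
  {x | ∃ c ∈ s, x c < a ∧ ∀ j ∈ s, v c < v j → b < x j}

/-- No candidate of `s` arriving in `[a, b)` is better than all candidates of `s` arriving
before `a`. -/
def noRecord (v : ι → ℝ) (s : Finset ι) (a b : ℝ) : Set (ι → ℝ) :=
  {x | ∀ j ∈ s, a ≤ x j → x j < b → ∃ k ∈ s, x k < a ∧ v j < v k}

omit [Fintype ι] [DecidableEq ι] in
theorem measurableSet_badBefore (bad : ι → Prop) (s : Finset ι) (b : ℝ) :
    MeasurableSet (badBefore bad s b) := by
  have : badBefore bad s b = ⋃ j ∈ s, ⋃ (_ : bad j), {x | x j < b} := by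
    ext; simp [badBefore, and_left_comm]
  rw [this]
  exact Finset.measurableSet_biUnion _ fun j _ => MeasurableSet.iUnion fun _ =>
    measurableSet_lt (measurable_pi_apply j) measurable_const

omit [Fintype ι] [DecidableEq ι] in
theorem measurableSet_allAfter (s : Finset ι) (b : ℝ) :
    MeasurableSet (allAfter s b) := by
  have : allAfter s b = ⋂ j ∈ s, {x : ι → ℝ | b < x j} := by
    ext; simp [allAfter]
  rw [this]
  exact Finset.measurableSet_biInter _ fun j _ =>
    measurableSet_lt measurable_const (measurable_pi_apply j)

omit [Fintype ι] [DecidableEq ι] in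
theorem measurableSet_bestEarly (v : ι → ℝ) (s : Finset ι) (a b : ℝ) :
    MeasurableSet (bestEarly v s a b) := by
  have : bestEarly v s a b = ⋃ c ∈ s, ({x | x c < a} ∩
      ⋂ j ∈ s, ⋂ (_ : v c < v j), {x | b < x j}) := by
    ext; simp [bestEarly, and_left_comm]
  rw [this]
  exact Finset.measurableSet_biUnion _ fun c _ =>
    (measurableSet_lt (measurable_pi_apply c) measurable_const).inter
      (Finset.measurableSet_biInter _ fun j _ => MeasurableSet.iInter fun _ =>
        measurableSet_lt measurable_const (measurable_pi_apply j))

omit [Fintype ι] [DecidableEq ι] in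
theorem measurableSet_noRecord (v : ι → ℝ) (s : Finset ι) (a b : ℝ) :
    MeasurableSet (noRecord v s a b) := by
  have : noRecord v s a b = ⋂ j ∈ s, ({x | x j < a} ∪ {x | b ≤ x j} ∪
      ⋃ k ∈ s, ⋃ (_ : v j < v k), {x | x k < a}) := by
    ext x
    simp only [noRecord, Set.mem_ofPred_eq, Set.mem_iInter, Set.mem_union, Set.mem_iUnion]
    refine forall₂_congr fun j _ => ⟨fun h => ?_, fun h h1 h2 => ?_⟩
    · by_cases h1 : a ≤ x j
      · by_cases h2 : x j < b
        · obtain ⟨k, hk, hk'⟩ := h h1 h2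
          exact Or.inr ⟨k, hk, hk'.2, hk'.1⟩
        · exact Or.inl (Or.inr (not_lt.mp h2))
      · exact Or.inl (Or.inl (not_le.mp h1))
    · rcases h with (h | h) | ⟨k, hk, hv, hx⟩
      · exact absurd h1 (not_le.mpr h)
      · exact absurd h2 (not_lt.mpr h)
      · exact ⟨k, hk, hx, hv⟩
  rw [this]
  refine Finset.measurableSet_biInter _ fun j _ => (MeasurableSet.union ?_ ?_).union ?_
  · exact measurableSet_lt (measurable_pi_apply j) measurable_const
  · exact measurableSet_le measurable_const (measurable_pi_apply j)
  · exact Finset.measurableSet_biUnion _ fun k _ => MeasurableSet.iUnion fun _ =>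
      measurableSet_lt (measurable_pi_apply k) measurable_const

omit [Fintype ι] in
theorem update_mem_badBefore {bad : ι → Prop} {s : Finset ι} {b : ℝ} {i : ι} (hi : i ∉ s)
    (x : ι → ℝ) (t : ℝ) : Function.update x i t ∈ badBefore bad s b ↔ x ∈ badBefore bad s b := by
  refine exists_congr fun j => and_congr_right fun hj => ?_
  rw [Function.update_of_ne (ne_of_mem_of_not_mem hj hi)]

omit [Fintype ι] in
theorem update_mem_allAfter {s : Finset ι} {b : ℝ} {i : ι} (hi : i ∉ s)
    (x : ι → ℝ) (t : ℝ) : Function.update x i t ∈ allAfter s b ↔ x ∈ allAfter s b := by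
  refine forall₂_congr fun j hj => ?_
  rw [Function.update_of_ne (ne_of_mem_of_not_mem hj hi)]

omit [Fintype ι] in
theorem update_mem_bestEarly {v : ι → ℝ} {s : Finset ι} {a b : ℝ} {i : ι} (hi : i ∉ s)
    (x : ι → ℝ) (t : ℝ) :
    Function.update x i t ∈ bestEarly v s a b ↔ x ∈ bestEarly v s a b := by
  refine exists_congr fun j => and_congr_right fun hj => ?_
  rw [Function.update_of_ne (ne_of_mem_of_not_mem hj hi)]
  refine and_congr_right fun _ => forall₂_congr fun k hk => ?_
  rw [Function.update_of_ne (ne_of_mem_of_not_mem hk hi)]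

omit [Fintype ι] in
theorem update_mem_noRecord {v : ι → ℝ} {s : Finset ι} {a b : ℝ} {i : ι} (hi : i ∉ s)
    (x : ι → ℝ) (t : ℝ) :
    Function.update x i t ∈ noRecord v s a b ↔ x ∈ noRecord v s a b := by
  refine forall₂_congr fun j hj => ?_
  rw [Function.update_of_ne (ne_of_mem_of_not_mem hj hi)]
  refine imp_congr_right fun _ => imp_congr_right fun _ => exists_congr fun k =>
    and_congr_right fun hk => ?_
  rw [Function.update_of_ne (ne_of_mem_of_not_mem hk hi)]

variable (μ : ι → Measure ℝ) [∀ i, IsProbabilityMeasure (μ i)]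

open Classical in
theorem measureReal_allAfter (s : Finset ι) (hs : ∀ i ∈ s, μ i = unif) {b : ℝ} (h0 : 0 ≤ b)
    (h1 : b ≤ 1) : (Measure.pi μ).real (allAfter s b) = (1 - b) ^ s.card := by
  induction s using Finset.induction_on with
  | empty => simp [allAfter]
  | insert c s hc ih =>
    have h : allAfter (insert c s) b = {x | x c ∈ Set.Ioi b} ∩ allAfter s b := by
      ext x; simp [allAfter]
    rw [h, measureReal_coord_inter μ c measurableSet_Ioi (measurableSet_allAfter s b)
      (update_mem_allAfter hc), ih fun i hi => hs i (Finset.mem_insert_of_mem hi),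
      hs c (Finset.mem_insert_self c s), unif_real_Ioi h0 h1, Finset.card_insert_of_notMem hc]
    ring

open Classical in
theorem le_measureReal_badBefore (bad : ι → Prop) (s : Finset ι) (hs : ∀ i ∈ s, μ i = unif)
    {b : ℝ} (h0 : 0 ≤ b) (h1 : b ≤ 1) :
    1 - (1 - b) ^ (s.filter bad).card ≤ (Measure.pi μ).real (badBefore bad s b) := by
  induction s using Finset.induction_on with
  | empty => simp
  | insert c s hc ih =>
    have ih := ih fun i hi => hs i (Finset.mem_insert_of_mem hi)
    by_cases hb : bad c
    · have hsub : ({x | x c ∈ Set.Iio b} ∩ Set.univ) ∪ ({x | x c ∈ Set.Ici b} ∩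
          badBefore bad s b) ⊆ badBefore bad (insert c s) b := by
        rintro x (⟨hx, _⟩ | ⟨_, j, hj, hx⟩)
        · exact ⟨c, Finset.mem_insert_self c s, hb, hx⟩
        · exact ⟨j, Finset.mem_insert_of_mem hj, hx⟩
      have hdisj : Disjoint ({x : ι → ℝ | x c ∈ Set.Iio b} ∩ Set.univ)
          ({x | x c ∈ Set.Ici b} ∩ badBefore bad s b) := by
        rw [Set.disjoint_left]
        rintro x ⟨hx, _⟩ ⟨hx', _⟩
        simp only [Set.mem_ofPred_eq, Set.mem_Iio, Set.mem_Ici] at hx hx'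
        linarith
      have hIci : unif.real (Set.Ici b) = 1 - b := by
        rw [← unif_real_Ioi h0 h1]; exact measureReal_congr Ioi_ae_eq_Ici.symm
      have hle := measureReal_mono (μ := Measure.pi μ) hsub
      rw [measureReal_union hdisj ((measurable_pi_apply c measurableSet_Ici).inter
        (measurableSet_badBefore bad s b)),
        measureReal_coord_inter μ c measurableSet_Iio MeasurableSet.univ (by simp),
        measureReal_coord_inter μ c measurableSet_Ici (measurableSet_badBefore bad s b)
          (update_mem_badBefore hc), hs c (Finset.mem_insert_self c s), unif_real_Iio h0 h1,
        hIci, probReal_univ] at hle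
      rw [Finset.filter_insert, if_pos hb, Finset.card_insert_of_notMem (by simp [hc])]
      have := mul_le_mul_of_nonneg_left ih (sub_nonneg.mpr h1)
      rw [pow_succ]
      linarith
    · rw [Finset.filter_insert, if_neg hb]
      refine ih.trans (measureReal_mono ?_)
      rintro x ⟨j, hj, hx⟩
      exact ⟨j, Finset.mem_insert_of_mem hj, hx⟩

open Classical in
/-- A lower bound for the probability that the best candidate of `U` arriving until `b` arrives
before `a`, or, if none of them arrives until `b`, that an event `B` about candidates of `L`
occurs (with weight `w`), while in the first case (unless `W` holds) some bad candidate
arrives before `β`. -/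
theorem le_bestEarly_add_allAfter (v : ι → ℝ) (bad : ι → Prop) (W : Prop) (L U : Finset ι)
    (hLU : Disjoint L U) (hL : ∀ i ∈ L, μ i = unif) (hU : ∀ i ∈ U, μ i = unif)
    {a b β z w : ℝ} (ha : 0 ≤ a) (haβ : a ≤ β) (hβb : β ≤ b) (hb : b ≤ 1) (hz : 0 ≤ z)
    (hzb : z * b ≤ a) {B : Set (ι → ℝ)} (hB : MeasurableSet B)
    (hBdep : ∀ i ∉ L, ∀ x t, Function.update x i t ∈ B ↔ x ∈ B)
    (hBz : z * (1 - (if W then 0 else 1) * (1 - β) ^ (L.filter bad).card) ≤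
      w * (Measure.pi μ).real B) :
    z * (1 - (if W then 0 else 1) * (1 - β) ^ ((L ∪ U).filter bad).card) ≤
      (Measure.pi μ).real (bestEarly v U a b ∩ {x | W ∨ x ∈ badBefore bad (L ∪ U) β}) +
        w * (Measure.pi μ).real (allAfter U b ∩ B) := by
  have hβ0 : 0 ≤ β := ha.trans haβ
  have hβ1 : β ≤ 1 := hβb.trans hb
  have hmW : ∀ s : Finset ι, MeasurableSet {x | W ∨ x ∈ badBefore bad s β} := fun s =>
    (MeasurableSet.const W).union (measurableSet_badBefore bad s β)
  -- Candidates are added by increasing value, so the new `c` beats all of `s`: before `a` it is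
  -- itself the early best one, and after `b` it does not disturb the event for `s`.
  induction U using Finset.induction_on_max_value v with
  | empty =>
    have h1 : allAfter (∅ : Finset ι) b ∩ B = B := by simp [allAfter]
    have h2 : bestEarly v (∅ : Finset ι) a b = ∅ := by simp [bestEarly]
    simpa [h1, h2] using hBz
  | insert c s hc hmax ih =>
    have hcL : c ∉ L := fun h => (Finset.disjoint_left.mp hLU h) (Finset.mem_insert_self c s)
    have hcLs : c ∉ L ∪ s := by simp [hc, hcL]
    have hμc := hU c (Finset.mem_insert_self c s)
    have ih := ih (Finset.disjoint_of_subset_right (Finset.subset_insert c s) hLU)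
      (fun i hi => hU i (Finset.mem_insert_of_mem hi))
    have hI : L ∪ insert c s = insert c (L ∪ s) := by ext; simp
    set G := bestEarly v s a b ∩ {x | W ∨ x ∈ badBefore bad (L ∪ s) β} with hG
    have hGm : MeasurableSet G := (measurableSet_bestEarly v s a b).inter (hmW _)
    have hGdep : ∀ x t, Function.update x c t ∈ G ↔ x ∈ G := fun x t =>
      and_congr (update_mem_bestEarly hc x t)
        (or_congr Iff.rfl (update_mem_badBefore hcLs x t))
    have hall : allAfter (insert c s) b ∩ B = {x | x c ∈ Set.Ioi b} ∩ (allAfter s b ∩ B) := by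
      ext x; simp [allAfter, and_assoc]
    have hallm : (Measure.pi μ).real (allAfter (insert c s) b ∩ B) =
        (1 - b) * (Measure.pi μ).real (allAfter s b ∩ B) := by
      rw [hall, measureReal_coord_inter μ c measurableSet_Ioi
        ((measurableSet_allAfter s b).inter hB)
        (fun x t => and_congr (update_mem_allAfter hc x t) (hBdep c hcL x t)), hμc,
        unif_real_Ioi (hβ0.trans hβb) hb]
    -- Either `c` is early and `V` provides the bad candidate, or `c` arrives after `b`.
    have key : ∀ V : Set (ι → ℝ), MeasurableSet V →
        (∀ x t, Function.update x c t ∈ V ↔ x ∈ V) →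
        (∀ x, x c < a → x ∈ V → W ∨ x ∈ badBefore bad (insert c (L ∪ s)) β) →
        a * (Measure.pi μ).real V + (1 - b) * (Measure.pi μ).real G ≤
          (Measure.pi μ).real (bestEarly v (insert c s) a b ∩
            {x | W ∨ x ∈ badBefore bad (insert c (L ∪ s)) β}) := by
      intro V hV hVdep hVsub
      have hsub : ({x | x c ∈ Set.Iio a} ∩ V) ∪ ({x | x c ∈ Set.Ioi b} ∩ G) ⊆
          bestEarly v (insert c s) a b ∩
            {x | W ∨ x ∈ badBefore bad (insert c (L ∪ s)) β} := by
        rintro x (⟨hx, hxV⟩ | ⟨hx, ⟨d, hd, hda, hdm⟩, hxW⟩)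
        · refine ⟨⟨c, Finset.mem_insert_self c s, hx, fun j hj hvj => ?_⟩, hVsub x hx hxV⟩
          rcases Finset.mem_insert.mp hj with rfl | hj
          · exact absurd hvj (lt_irrefl _)
          · exact absurd hvj (not_lt.mpr (hmax j hj))
        · refine ⟨⟨d, Finset.mem_insert_of_mem hd, hda, fun j hj hvj => ?_⟩, ?_⟩
          · rcases Finset.mem_insert.mp hj with rfl | hj
            · exact hx
            · exact hdm j hj hvj
          · rcases hxW with h | ⟨j, hj, h⟩
            · exact Or.inl h
            · exact Or.inr ⟨j, Finset.mem_insert_of_mem hj, h⟩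
      have hdisj : Disjoint ({x : ι → ℝ | x c ∈ Set.Iio a} ∩ V)
          ({x | x c ∈ Set.Ioi b} ∩ G) := by
        rw [Set.disjoint_left]
        rintro x ⟨hx, _⟩ ⟨hx', _⟩
        simp only [Set.mem_ofPred_eq, Set.mem_Iio, Set.mem_Ioi] at hx hx'
        linarith
      have hle := measureReal_mono (μ := Measure.pi μ) hsub
      rwa [measureReal_union hdisj ((measurable_pi_apply c measurableSet_Ioi).inter hGm),
        measureReal_coord_inter μ c measurableSet_Iio hV hVdep,
        measureReal_coord_inter μ c measurableSet_Ioi hGm hGdep, hμc,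
        unif_real_Iio ha (by linarith), unif_real_Ioi (by linarith) hb] at hle
    rw [hI, hallm]
    set p := (1 - β) ^ ((L ∪ s).filter bad).card with hp
    have hp0 : 0 ≤ p := pow_nonneg (by linarith) _
    set ω : ℝ := if W then 0 else 1 with hω
    have hω0 : 0 ≤ ω := by rw [hω]; split_ifs <;> norm_num
    have ih' := mul_le_mul_of_nonneg_left ih (sub_nonneg.mpr hb)
    by_cases hbad : bad c
    · have hk := key Set.univ MeasurableSet.univ (by simp) (fun x hx _ =>
        Or.inr ⟨c, Finset.mem_insert_self c _, hbad, by linarith⟩)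
      rw [probReal_univ] at hk
      have hcard : ((insert c (L ∪ s)).filter bad).card = ((L ∪ s).filter bad).card + 1 := by
        rw [Finset.filter_insert, if_pos hbad, Finset.card_insert_of_notMem]
        exact fun h => hcLs (Finset.mem_of_mem_filter c h)
      rw [hcard, pow_succ, ← hp]
      -- The two cases for `c` give at least `z * (1 - (1 - b) * ω * p)`; this product is the
      -- surplus over the claim.
      have : 0 ≤ z * ω * p * (b - β) := by
        have := sub_nonneg.mpr hβb
        positivity
      linarith
    -- A good `c` cannot supply the bad arrival, so `L ∪ s` must; the exponent stays the same and `z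
    -- * b ≤ a` closes the recursion.
    · have hk := key {x | W ∨ x ∈ badBefore bad (L ∪ s) β} (hmW _)
        (fun x t => or_congr Iff.rfl (update_mem_badBefore hcLs x t)) (fun x _ hx => by
          rcases hx with h | ⟨j, hj, h⟩
          · exact Or.inl h
          · exact Or.inr ⟨j, Finset.mem_insert_of_mem hj, h⟩)
      rw [Finset.filter_insert, if_neg hbad, ← hp]
      have hV : 1 - ω * p ≤ (Measure.pi μ).real {x | W ∨ x ∈ badBefore bad (L ∪ s) β} := by
        by_cases hW : W
        · simp [hω, hW]
        · have := le_measureReal_badBefore μ bad (L ∪ s) (fun i hi => by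
            rcases Finset.mem_union.mp hi with h | h
            · exact hL i h
            · exact hU i (Finset.mem_insert_of_mem h)) hβ0 hβ1
          simpa [hω, hW] using this
      have h1 := mul_le_mul_of_nonneg_left hV ha
      have hωp : 0 ≤ 1 - ω * p := by
        have : p ≤ 1 := pow_le_one₀ (by linarith) (by linarith)
        rw [hω]; split_ifs <;> linarith
      have h2 := mul_le_mul_of_nonneg_right hzb hωp
      linarith

open Classical in
/-- Among candidates with uniform arrival times, the best one until `b` arrives before `a` with
probability at least `a / b`, also jointly with the arrival of some bad candidate until `b`. -/
theorem le_measureReal_noRecord (v : ι → ℝ) (bad : ι → Prop) (W : Prop) (s : Finset ι)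
    (hs : ∀ i ∈ s, μ i = unif) (hv : Function.Injective v) {a b : ℝ} (ha : 0 ≤ a) (hab : a ≤ b)
    (hb0 : 0 < b) (hb : b ≤ 1) :
    a / b * (1 - (if W then 0 else 1) * (1 - b) ^ (s.filter bad).card) ≤
      (Measure.pi μ).real (noRecord v s a b ∩ {x | W ∨ x ∈ badBefore bad s b}) := by
  have hab1 : a / b ≤ 1 := (div_le_one hb0).mpr hab
  -- With `L` empty and `B` the event `W`, runs without any arrival until `b` count exactly when no
  -- bad arrival is required.
  have h := le_bestEarly_add_allAfter μ v bad W ∅ s (by simp) (by simp) hs ha hab le_rfl hb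
    (z := a / b) (w := 1) (by positivity) (by rw [div_mul_cancel₀ _ hb0.ne'])
    (B := {_x | W}) (MeasurableSet.const W) (by simp) (by
      by_cases hW : W <;> simp [hW, hab1])
  rw [Finset.empty_union, one_mul, ← measureReal_union] at h
  · refine h.trans (measureReal_mono ?_)
    rintro x (⟨⟨c, hc, hca, hcm⟩, hx⟩ | ⟨hx, hW⟩)
    · refine ⟨fun j hj hj1 hj2 => ⟨c, hc, hca, ?_⟩, hx⟩
      rcases lt_trichotomy (v j) (v c) with h | h | h
      · exact h
      · rw [hv h] at hj1; linarith
      · have := hcm j hj h; linarith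
    · exact ⟨fun j hj _ hj2 => absurd hj2 (not_lt.mpr (hx j hj).le), Or.inl hW⟩
  · rw [Set.disjoint_left]
    rintro x ⟨⟨c, hc, hca, _⟩, _⟩ ⟨hx, _⟩
    have := hx c hc
    linarith
  · exact (measurableSet_allAfter s b).inter (MeasurableSet.const W)

end Records

/-! ### Decision rule for fixed arrival times and seed -/

section Deterministic

variable {n : ℕ} (P : Params) (v vhat : Fin n → ℝ) (top : Fin n)

/-- The prediction error of candidate `i` exceeds the threshold. -/
def IsBad (i : Fin n) : Prop := P.θ < predError (v i) (vhat i)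

/-- Candidate `b` is the first one in arrival order with a prediction error above the threshold. -/
def IsFirstBad (x : Fin n → ℝ) (b : Fin n) : Prop :=
  IsBad P v vhat b ∧ ∀ c, IsBad P v vhat c → x b ≤ x c

open Classical in
/-- The mode in which the decision on candidate `i` is made, if nobody has been hired before. -/
noncomputable def modeAt (x : Fin n → ℝ) (i : Fin n) : Mode :=
  if h : ∃ b, IsFirstBad P v vhat x b ∧ x b ≤ x i then Mode.secretary (x h.choose)
  else Mode.prediction

variable {P v vhat top} {x : Fin n → ℝ} {u : ℝ}

theorem exists_isFirstBad {c : Fin n} (hc : IsBad P v vhat c) :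
    ∃ b, IsFirstBad P v vhat x b := by
  classical
  obtain ⟨b, hb, hmin⟩ := Finset.exists_min_image
    (Finset.univ.filter (IsBad P v vhat)) x ⟨c, by simpa using hc⟩
  exact ⟨b, by simpa using hb, fun d hd => hmin d (by simpa using hd)⟩

theorem modeAt_eq_prediction {i : Fin n} (h : ∀ b, IsBad P v vhat b → x i < x b) :
    modeAt P v vhat x i = Mode.prediction := by
  rw [modeAt, dif_neg]
  rintro ⟨b, hb, hi⟩
  exact absurd hi (not_le.mpr (h b hb.1))

theorem modeAt_eq_secretary {b i : Fin n} (hb : IsFirstBad P v vhat x b) (hi : x b ≤ x i) :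
    modeAt P v vhat x i = Mode.secretary (x b) := by
  have h : ∃ b, IsFirstBad P v vhat x b ∧ x b ≤ x i := ⟨b, hb, hi⟩
  rw [modeAt, dif_pos h]
  congr 1
  exact le_antisymm (h.choose_spec.1.2 b hb.1) (hb.2 _ h.choose_spec.1.1)

/-- Loop invariant: the candidates outside `l` are those already processed, and `m` reflects whether
a bad one is among them. Hence the loop always decides in the mode `modeAt`, and its recursion can
be forgotten. -/
theorem loop_eq_some {i : Fin n} (hx : Function.Injective x)
    (hi : hires P v top x u i (modeAt P v vhat x i))
    (hj : ∀ j, x j < x i → ¬ hires P v top x u j (modeAt P v vhat x j)) (l : List (Fin n)) :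
    ∀ m : Mode, l.Pairwise (fun a b => x a < x b) → (∀ k, k ∉ l → ∀ j ∈ l, x k < x j) →
      ((∀ k, k ∉ l → ¬ IsBad P v vhat k) → m = Mode.prediction) →
      (∀ b, b ∉ l → IsFirstBad P v vhat x b → m = Mode.secretary (x b)) → i ∈ l →
      loop P v vhat top x u m l = some i := by
  induction l with
  | nil => intro m _ _ _ _ h; simp at h
  | cons a l ih =>
    intro m hp hout hpre hsec hil
    rw [List.pairwise_cons] at hp
    have hmode : nextMode P v vhat x a m = modeAt P v vhat x a := by
      by_cases hb : ∃ b, b ∉ a :: l ∧ IsFirstBad P v vhat x b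
      · obtain ⟨b, hbl, hb⟩ := hb
        rw [hsec b hbl hb, modeAt_eq_secretary hb (hout b hbl a (by simp)).le, nextMode]
      · have hno : ∀ k, k ∉ a :: l → ¬ IsBad P v vhat k := by
          intro k hk hkb
          obtain ⟨b, hfb⟩ := exists_isFirstBad (x := x) hkb
          refine hb ⟨b, fun hbl => ?_, hfb⟩
          exact absurd (hfb.2 k hkb) (not_le.mpr (hout k hk b hbl))
        rw [hpre hno, nextMode]
        have hmin : ∀ c, IsBad P v vhat c → x a ≤ x c := by
          intro c hc
          have hcl : c ∈ a :: l := by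
            by_contra h; exact hno c h hc
          rcases List.mem_cons.mp hcl with rfl | h
          · exact le_rfl
          · exact (hp.1 c h).le
        split_ifs with ha
        · exact (modeAt_eq_secretary ⟨ha, hmin⟩ le_rfl).symm
        · refine (modeAt_eq_prediction fun b hb => lt_of_le_of_ne (hmin b hb) ?_).symm
          intro h
          exact ha (hx h ▸ hb)
    rw [loop, hmode]
    by_cases hai : a = i
    · subst hai; rw [if_pos hi]
    · have hil' : i ∈ l := by
        rcases List.mem_cons.mp hil with h | h
        · exact absurd h.symm hai
        · exact h
      rw [if_neg (hj a (hp.1 i hil'))]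
      have hal : a ∉ l := fun h => lt_irrefl _ (hp.1 a h)
      have hcase : ∀ k, k ∉ l → k = a ∨ k ∉ a :: l := by
        intro k hk
        by_cases h : k = a
        · exact Or.inl h
        · exact Or.inr (by simp [h, hk])
      have hle : ∀ k, k ∉ l → x k ≤ x a := by
        intro k hk
        rcases hcase k hk with rfl | h
        · exact le_rfl
        · exact (hout k h a (by simp)).le
      refine ih _ hp.2 ?_ ?_ ?_ hil'
      · intro k hk j hj
        exact (hle k hk).trans_lt (hp.1 j hj)
      · intro hno
        refine modeAt_eq_prediction fun b hb => hp.1 b ?_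
        by_contra h
        exact hno b h hb
      · intro b hbl hb
        exact modeAt_eq_secretary hb (hle b hbl)

/-- A candidate is hired if the decision rule accepts it and no earlier candidate. -/
theorem run_eq_some {i : Fin n} (hx : Function.Injective x)
    (hi : hires P v top x u i (modeAt P v vhat x i))
    (hj : ∀ j, x j < x i → ¬ hires P v top x u j (modeAt P v vhat x j)) :
    run P v vhat top x u = some i := by
  have hall : ∀ k, k ∈ List.ofFn (Tuple.sort x) := fun k => by
    rw [List.mem_ofFn]; exact (Tuple.sort x).surjective k
  refine loop_eq_some hx hi hj _ _ ?_ ?_ ?_ ?_ (hall i)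
  · rw [List.pairwise_ofFn]
    intro a b hab
    exact lt_of_le_of_ne (Tuple.monotone_sort x hab.le)
      (fun h => hab.ne ((Tuple.sort x).injective (hx h)))
  · intro k hk; exact absurd (hall k) hk
  · intro _; rfl
  · intro b hb; exact absurd (hall b) hb

theorem not_hires_of_ne_top {j : Fin n} (hj : j ≠ top)
    (h : (∀ b, IsBad P v vhat b → x j < x b) ∨ x j ≤ P.τ ∨ ∃ k, x k < x j ∧ v j ≤ v k) :
    ¬ hires P v top x u j (modeAt P v vhat x j) := by
  rcases h with h | h
  · rw [modeAt_eq_prediction h]; exact hj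
  · cases modeAt P v vhat x j with
    | prediction => exact hj
    | secretary tM =>
      rintro ⟨h1, h2, _⟩
      rcases h with h | ⟨k, hk, hv⟩
      · linarith
      · exact absurd (h2 k hk) (not_lt.mpr hv)

/-- In the last alternative only `top` itself can have caused the switch, so the relevant
probability is `γ` alone. -/
theorem not_hires_top {b : Fin n} (hb : IsBad P v vhat b) (hbt : x b ≤ x top)
    (h : (∃ k, x k < x top ∧ v top ≤ v k) ∨ (P.γ ≤ u ∧ P.δ ≤ u) ∨
      (P.γ ≤ u ∧ ∀ c, c ≠ top → IsBad P v vhat c → x top < x c)) :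
    ¬ hires P v top x u top (modeAt P v vhat x top) := by
  obtain ⟨c, hc⟩ := exists_isFirstBad (x := x) hb
  rw [modeAt_eq_secretary hc ((hc.2 b hb).trans hbt)]
  rintro ⟨h1, h2, h3⟩
  rcases h with ⟨k, hk, hv⟩ | ⟨hγ, hδ⟩ | ⟨hγ, hc'⟩
  · exact absurd (h2 k hk) (not_lt.mpr hv)
  · by_cases h : x top = x c
    · simp only [h, and_self, if_true] at h3; linarith
    · simp only [h, and_false, if_false, if_true] at h3; linarith
  · have : c = top := by
      by_contra hne
      exact absurd ((hc.2 b hb).trans hbt) (not_le.mpr (hc' c hne hc.1))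
    subst this
    simp only [and_self, if_true] at h3
    linarith

theorem hires_of_ne_top {b i : Fin n} (hi : i ≠ top) (hb : IsBad P v vhat b) (hbi : x b ≤ x i)
    (hτ : P.τ < x i) (hrec : ∀ j, x j < x i → v j < v i) :
    hires P v top x u i (modeAt P v vhat x i) := by
  obtain ⟨c, hc⟩ := exists_isFirstBad (x := x) hb
  rw [modeAt_eq_secretary hc ((hc.2 b hb).trans hbi)]
  exact ⟨hτ, hrec, by simp [hi]⟩

theorem hires_top_of_prediction (h : ∀ b, IsBad P v vhat b → x top < x b) :
    hires P v top x u top (modeAt P v vhat x top) := by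
  rw [modeAt_eq_prediction h]; rfl

theorem hires_top_of_first (hbad : IsBad P v vhat top)
    (h : ∀ b, b ≠ top → IsBad P v vhat b → x top < x b)
    (hτ : P.τ < x top) (hrec : ∀ j, x j < x top → v j < v top) (hu : u < P.γ) :
    hires P v top x u top (modeAt P v vhat x top) := by
  have hf : IsFirstBad P v vhat x top := by
    refine ⟨hbad, fun c hc => ?_⟩
    by_cases hct : c = top
    · rw [hct]
    · exact (h c hct hc).le
  rw [modeAt_eq_secretary hf le_rfl]
  exact ⟨hτ, hrec, by simpa using hu⟩

theorem hires_top_of_later {b : Fin n} (hb : IsBad P v vhat b) (hbt : x b < x top)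
    (hτ : P.τ < x top) (hrec : ∀ j, x j < x top → v j < v top) (hu : u < P.δ) :
    hires P v top x u top (modeAt P v vhat x top) := by
  obtain ⟨c, hc⟩ := exists_isFirstBad (x := x) hb
  have hct : x c < x top := (hc.2 b hb).trans_lt hbt
  rw [modeAt_eq_secretary hc hct.le]
  exact ⟨hτ, hrec, by simpa [hct.ne'] using hu⟩

end Deterministic

/-! ### Measurability of the reward -/

section Measurability

variable {n : ℕ} (P : Params) (v vhat : Fin n → ℝ) (top : Fin n)

variable {P v vhat top} in
theorem loop_cons_of_hires {t : Fin n → ℝ} {u : ℝ} {m m' : Mode} {a : Fin n} {l : List (Fin n)}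
    (hm : nextMode P v vhat t a m = m') (h : hires P v top t u a m') :
    loop P v vhat top t u m (a :: l) = some a := by
  subst hm; rw [loop, if_pos h]

variable {P v vhat top} in
theorem loop_cons_of_not_hires {t : Fin n → ℝ} {u : ℝ} {m m' : Mode} {a : Fin n}
    {l : List (Fin n)} (hm : nextMode P v vhat t a m = m') (h : ¬ hires P v top t u a m') :
    loop P v vhat top t u m (a :: l) = loop P v vhat top t u m' l := by
  subst hm; rw [loop, if_neg h]

theorem measurableSet_hires_secretary (i j : Fin n) :
    MeasurableSet {ω : (Fin n → ℝ) × ℝ |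
      hires P v top ω.1 ω.2 i (Mode.secretary (ω.1 j))} := by
  have hc : ∀ k, Measurable fun ω : (Fin n → ℝ) × ℝ => ω.1 k := fun k =>
    (measurable_pi_apply k).comp measurable_fst
  have h1 : MeasurableSet {ω : (Fin n → ℝ) × ℝ | P.τ < ω.1 i} :=
    measurableSet_lt measurable_const (hc i)
  have h2 : MeasurableSet {ω : (Fin n → ℝ) × ℝ | ∀ k, ω.1 k < ω.1 i → v k < v i} :=
    measurableSet_setOfPred.mpr <| Measurable.forall fun k =>
      (measurableSet_setOfPred.mp (measurableSet_lt (hc k) (hc i))).imp measurable_const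
  have h3 : MeasurableSet {ω : (Fin n → ℝ) × ℝ |
      if i = top ∧ ω.1 i = ω.1 j then ω.2 < P.γ else if i = top then ω.2 < P.δ else True} := by
    by_cases hi : i = top
    · simp only [hi, true_and, if_true]
      have h4 := measurableSet_eq_fun (hc top) (hc j)
      have : {ω : (Fin n → ℝ) × ℝ |
          if ω.1 top = ω.1 j then ω.2 < P.γ else ω.2 < P.δ} =
          {ω | ω.1 top = ω.1 j} ∩ {ω | ω.2 < P.γ} ∪
            {ω | ω.1 top = ω.1 j}ᶜ ∩ {ω | ω.2 < P.δ} := by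
        ext ω
        by_cases h : ω.1 top = ω.1 j <;> simp [h]
      rw [this]
      exact (h4.inter (measurableSet_lt measurable_snd measurable_const)).union
        (h4.compl.inter (measurableSet_lt measurable_snd measurable_const))
    · simp [hi]
  exact h1.inter (h2.inter h3)

/-- A switching time is always some candidate's arrival time, so it suffices to follow modes whose
time is a coordinate `ω.1 j`. -/
theorem measurable_reward_loop_secretary (l : List (Fin n)) (j : Fin n) :
    Measurable fun ω : (Fin n → ℝ) × ℝ =>
      reward v (loop P v vhat top ω.1 ω.2 (Mode.secretary (ω.1 j)) l) := by
  induction l with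
  | nil => simp only [loop]; exact measurable_const
  | cons a l ih =>
    have : (fun ω : (Fin n → ℝ) × ℝ =>
        reward v (loop P v vhat top ω.1 ω.2 (Mode.secretary (ω.1 j)) (a :: l))) = fun ω =>
        open Classical in
        if ω ∈ {ω : (Fin n → ℝ) × ℝ | hires P v top ω.1 ω.2 a (Mode.secretary (ω.1 j))} then v a
        else reward v (loop P v vhat top ω.1 ω.2 (Mode.secretary (ω.1 j)) l) := by
      funext ω
      simp only [Set.mem_ofPred_eq]
      split_ifs with h
      · rw [loop_cons_of_hires rfl h]; rfl
      · rw [loop_cons_of_not_hires rfl h]; rfl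
    rw [this]
    exact Measurable.ite (measurableSet_hires_secretary P v top a j) measurable_const ih

theorem measurable_reward_loop_prediction (l : List (Fin n)) :
    Measurable fun ω : (Fin n → ℝ) × ℝ =>
      reward v (loop P v vhat top ω.1 ω.2 Mode.prediction l) := by
  classical
  induction l with
  | nil => simp only [loop]; exact measurable_const
  | cons a l ih =>
    by_cases hb : P.θ < predError (v a) (vhat a)
    -- A bad head switches at its own arrival time; starting in Secretary mode with that time makes
    -- no difference.
    · have h := measurable_reward_loop_secretary P v vhat top (a :: l) a
      have he : ∀ ω : (Fin n → ℝ) × ℝ, loop P v vhat top ω.1 ω.2 Mode.prediction (a :: l) =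
          loop P v vhat top ω.1 ω.2 (Mode.secretary (ω.1 a)) (a :: l) := by
        intro ω
        have h1 : nextMode P v vhat ω.1 a Mode.prediction = Mode.secretary (ω.1 a) := if_pos hb
        by_cases h2 : hires P v top ω.1 ω.2 a (Mode.secretary (ω.1 a))
        · rw [loop_cons_of_hires h1 h2, loop_cons_of_hires rfl h2]
        · rw [loop_cons_of_not_hires h1 h2, loop_cons_of_not_hires rfl h2]; rfl
      simpa only [he] using h
    · have h1 : ∀ t, nextMode P v vhat t a Mode.prediction = Mode.prediction := fun t => if_neg hb
      by_cases ha : a = top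
      · have he : ∀ ω : (Fin n → ℝ) × ℝ, loop P v vhat top ω.1 ω.2 Mode.prediction (a :: l) =
            some a := fun ω => loop_cons_of_hires (h1 _) ha
        simp only [he]; exact measurable_const
      · have he : ∀ ω : (Fin n → ℝ) × ℝ, loop P v vhat top ω.1 ω.2 Mode.prediction (a :: l) =
            loop P v vhat top ω.1 ω.2 Mode.prediction l :=
          fun ω => loop_cons_of_not_hires (h1 _) ha
        simpa only [he] using ih

/-- The reward is split over the finitely many processing orders; for each of them the loop runs
over a fixed list. -/
theorem measurable_reward_run :
    Measurable fun ω : (Fin n → ℝ) × ℝ => reward v (run P v vhat top ω.1 ω.2) := by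
  classical
  have hS : ∀ σ : Equiv.Perm (Fin n),
      MeasurableSet {ω : (Fin n → ℝ) × ℝ | σ = Tuple.sort ω.1} := by
    intro σ
    have hc : ∀ k, Measurable fun ω : (Fin n → ℝ) × ℝ => ω.1 k := fun k =>
      (measurable_pi_apply k).comp measurable_fst
    simp only [Tuple.eq_sort_iff, Monotone]
    refine MeasurableSet.inter ?_ ?_
    · exact measurableSet_setOfPred.mpr <| Measurable.forall fun a => Measurable.forall fun b =>
        measurable_const.imp (measurableSet_setOfPred.mp (measurableSet_le (hc _) (hc _)))
    · exact measurableSet_setOfPred.mpr <| Measurable.forall fun a => Measurable.forall fun b =>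
        measurable_const.imp ((measurableSet_setOfPred.mp
          (measurableSet_eq_fun (hc _) (hc _))).imp measurable_const)
  have : (fun ω : (Fin n → ℝ) × ℝ => reward v (run P v vhat top ω.1 ω.2)) = fun ω =>
      ∑ σ : Equiv.Perm (Fin n), Set.indicator {ω : (Fin n → ℝ) × ℝ | σ = Tuple.sort ω.1}
        (fun ω => reward v (loop P v vhat top ω.1 ω.2 Mode.prediction (List.ofFn σ))) ω := by
    funext ω
    rw [Finset.sum_eq_single (Tuple.sort ω.1)]
    · rw [Set.indicator_of_mem (by simp), run]
    · intro σ _ hσ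
      exact Set.indicator_of_notMem (by simpa using hσ) _
    · simp
  rw [this]
  exact Finset.measurable_sum _ fun σ _ =>
    (measurable_reward_loop_prediction P v vhat top _).indicator (hS σ)

end Measurability

/-! ### Averaging over the seed and the arrival times -/

section Averages

/-- Three disjoint events are the most that any case needs; superfluous ones are taken empty. -/
theorem sum_le_integral_of_le_on {α : Type*} [MeasurableSpace α] {ν : Measure α}
    [IsProbabilityMeasure ν] {F : α → ℝ} (hF : Integrable F ν) (hF0 : ∀ x, 0 ≤ F x)
    {A B C : Set α} (hA : MeasurableSet A) (hB : MeasurableSet B) (hC : MeasurableSet C)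
    (hAB : Disjoint A B) (hAC : Disjoint A C) (hBC : Disjoint B C) {a b c : ℝ}
    (ha : ∀ᵐ x ∂ν, x ∈ A → a ≤ F x) (hb : ∀ᵐ x ∂ν, x ∈ B → b ≤ F x)
    (hc : ∀ᵐ x ∂ν, x ∈ C → c ≤ F x) :
    a * ν.real A + b * ν.real B + c * ν.real C ≤ ∫ x, F x ∂ν := by
  have hi : ∀ (S : Set α) (s : ℝ), MeasurableSet S → Integrable (S.indicator fun _ => s) ν :=
    fun S s hS => (integrable_const s).indicator hS
  have h := integral_mono_ae (((hi A a hA).add (hi B b hB)).add (hi C c hC)) hF (by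
    filter_upwards [ha, hb, hc] with x hxa hxb hxc
    simp only [Pi.add_apply]
    by_cases h1 : x ∈ A
    · have h2 : x ∉ B := Set.disjoint_left.mp hAB h1
      have h3 : x ∉ C := Set.disjoint_left.mp hAC h1
      simpa [h1, h2, h3] using hxa h1
    · by_cases h2 : x ∈ B
      · have h3 : x ∉ C := Set.disjoint_left.mp hBC h2
        simpa [h1, h2, h3] using hxb h2
      · by_cases h3 : x ∈ C
        · simpa [h1, h2, h3] using hxc h3
        · simpa [h1, h2, h3] using hF0 x)
  rw [integral_add' ((hi A a hA).add (hi B b hB)) (hi C c hC),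
    integral_add' (hi A a hA) (hi B b hB), integral_indicator_const _ hA,
    integral_indicator_const _ hB, integral_indicator_const _ hC] at h
  simp only [smul_eq_mul] at h
  linarith

variable {n : ℕ} (P : Params) (v vhat : Fin n → ℝ) (top : Fin n)

/-- The expected reward for given arrival times. -/
noncomputable def avgReward (x : Fin n → ℝ) : ℝ :=
  ∫ u, reward v (run P v vhat top x u) ∂unif

/-- The distribution of the arrival time of candidate `i`. -/
noncomputable def timeLaw (β : ℝ) (i : Fin n) : Measure ℝ :=
  open Classical in if i = top then Measure.dirac β else unif

instance (β : ℝ) (i : Fin n) : IsProbabilityMeasure (timeLaw top β i) := by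
  unfold timeLaw; split_ifs <;> infer_instance

theorem arrivalLaw_eq (β : ℝ) : arrivalLaw top β = Measure.pi (timeLaw top β) := rfl

instance (β : ℝ) : IsProbabilityMeasure (arrivalLaw top β) := by
  rw [arrivalLaw_eq]; infer_instance

variable {top} in
theorem timeLaw_of_ne {β : ℝ} {i : Fin n} (hi : i ≠ top) : timeLaw top β i = unif := if_neg hi

theorem timeLaw_top (β : ℝ) : timeLaw top β top = Measure.dirac β := if_pos rfl

variable {v} in
theorem reward_nonneg (hv : ∀ i, 0 ≤ v i) (o : Option (Fin n)) : 0 ≤ reward v o := by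
  cases o with
  | none => exact le_rfl
  | some i => exact hv i

theorem le_bestValue (i : Fin n) : v i ≤ bestValue v :=
  le_ciSup (Set.finite_range v).bddAbove i

variable {v} in
theorem reward_le_bestValue (hv : ∀ i, 0 ≤ v i) (i : Fin n) (o : Option (Fin n)) :
    reward v o ≤ bestValue v := by
  cases o with
  | none => exact (hv i).trans (le_bestValue v i)
  | some i => exact le_bestValue v i

variable {v}

theorem integrable_reward_run (hv : ∀ i, 0 ≤ v i) {Ω : Type*} [MeasurableSpace Ω]
    {ν : Measure Ω} [IsFiniteMeasure ν] {f : Ω → (Fin n → ℝ) × ℝ} (hf : Measurable f) :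
    Integrable (fun ω => reward v (run P v vhat top (f ω).1 (f ω).2)) ν := by
  refine Integrable.of_bound ((measurable_reward_run P v vhat top).comp hf).aestronglyMeasurable
    (bestValue v) (Filter.Eventually.of_forall fun ω => ?_)
  rw [Real.norm_of_nonneg (reward_nonneg hv _)]
  exact reward_le_bestValue hv top _

theorem expectedReward_eq (hv : ∀ i, 0 ≤ v i) (β : ℝ) :
    expectedReward P β v vhat top = ∫ x, avgReward P v vhat top x ∂arrivalLaw top β := by
  exact integral_prod (fun ω => reward v (run P v vhat top ω.1 ω.2))
    (integrable_reward_run P vhat top hv measurable_id)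

theorem avgReward_nonneg (hv : ∀ i, 0 ≤ v i) (x : Fin n → ℝ) : 0 ≤ avgReward P v vhat top x :=
  integral_nonneg fun _ => reward_nonneg hv _

theorem avgReward_le (hv : ∀ i, 0 ≤ v i) (x : Fin n → ℝ) :
    avgReward P v vhat top x ≤ bestValue v := by
  have h := integral_mono (integrable_reward_run P vhat top hv (ν := unif)
    (measurable_const (a := x) |>.prodMk measurable_id)) (integrable_const (bestValue v))
    (fun u => reward_le_bestValue hv top _)
  rw [integral_const, probReal_univ, one_smul] at h
  exact h

theorem measurable_avgReward : Measurable (avgReward P v vhat top) :=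
  ((measurable_reward_run P v vhat top).stronglyMeasurable.integral_prod_right
    (f := fun x u => reward v (run P v vhat top x u))).measurable

theorem integrable_avgReward_comp (hv : ∀ i, 0 ≤ v i) {Ω : Type*} [MeasurableSpace Ω]
    {ν : Measure Ω} [IsFiniteMeasure ν] {f : Ω → (Fin n → ℝ)} (hf : Measurable f) :
    Integrable (fun ω => avgReward P v vhat top (f ω)) ν := by
  refine Integrable.of_bound ((measurable_avgReward P vhat top).comp hf).aestronglyMeasurable
    (bestValue v) (Filter.Eventually.of_forall fun ω => ?_)
  rw [Real.norm_of_nonneg (avgReward_nonneg P vhat top hv _)]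
  exact avgReward_le P vhat top hv _

variable {P vhat top}

theorem le_avgReward (hv : ∀ i, 0 ≤ v i) {x : Fin n → ℝ} {p a b : ℝ} (h0 : 0 ≤ p) (h1 : p ≤ 1)
    (ha : ∀ u < p, a ≤ reward v (run P v vhat top x u))
    (hb : ∀ u, p ≤ u → b ≤ reward v (run P v vhat top x u)) :
    p * a + (1 - p) * b ≤ avgReward P v vhat top x := by
  have h := sum_le_integral_of_le_on (ν := unif)
    (integrable_reward_run P vhat top hv (measurable_const (a := x) |>.prodMk measurable_id))
    (fun u => reward_nonneg hv _) (measurableSet_Iio (a := p)) (measurableSet_Ioi (a := p))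
    MeasurableSet.empty (a := a) (b := b) (c := 0)
    (by
      rw [Set.disjoint_left]; intro y hy hy'
      simp only [Set.mem_Iio, Set.mem_Ioi] at hy hy'; linarith) (by simp) (by simp)
    (Filter.Eventually.of_forall fun u hu => ha u hu)
    (Filter.Eventually.of_forall fun u hu => hb u (le_of_lt hu)) (by simp)
  rw [unif_real_Iio h0 h1, unif_real_Ioi h0 h1, zero_mul, add_zero] at h
  refine le_of_eq_of_le ?_ h
  ring

theorem le_avgReward_of_run (hv : ∀ i, 0 ≤ v i) {x : Fin n → ℝ} {i : Fin n}
    (h : ∀ u, run P v vhat top x u = some i) : v i ≤ avgReward P v vhat top x := by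
  have := le_avgReward (P := P) (vhat := vhat) (top := top) hv (x := x) (p := 0) (a := v i)
    (b := v i) le_rfl zero_le_one (fun u _ => by rw [h u]; rfl) (fun u _ => by rw [h u]; rfl)
  linarith

theorem le_avgReward_of_lt (hv : ∀ i, 0 ≤ v i) {x : Fin n → ℝ} {i : Fin n} {p : ℝ}
    (h0 : 0 ≤ p) (h1 : p ≤ 1) (h : ∀ u < p, run P v vhat top x u = some i) :
    p * v i ≤ avgReward P v vhat top x := by
  have := le_avgReward (P := P) (vhat := vhat) (top := top) hv (x := x) (a := v i)
    (b := 0) h0 h1 (fun u hu => by rw [h u hu]; rfl) (fun u _ => reward_nonneg hv _)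
  linarith

theorem le_avgReward_of_ge (hv : ∀ i, 0 ≤ v i) {x : Fin n → ℝ} {i : Fin n} {p : ℝ}
    (h0 : 0 ≤ p) (h1 : p ≤ 1) (h : ∀ u, p ≤ u → run P v vhat top x u = some i) :
    (1 - p) * v i ≤ avgReward P v vhat top x := by
  have := le_avgReward (P := P) (vhat := vhat) (top := top) hv (x := x) (a := 0)
    (b := v i) h0 h1 (fun u _ => reward_nonneg hv _) (fun u hu => by rw [h u hu]; rfl)
  linarith

variable (top)

theorem ae_top_eq (β : ℝ) : ∀ᵐ x ∂arrivalLaw top β, x top = β := by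
  rw [arrivalLaw_eq]
  have h := (measurePreserving_eval (timeLaw top β) top)
  have h2 : ∀ᵐ y ∂timeLaw top β top, y = β := by
    rw [timeLaw_top]
    exact (ae_dirac_iff (measurableSet_singleton β)).mpr rfl
  exact h.quasiMeasurePreserving.ae h2

/-- Given the other coordinates, a tie confines `x i` to one point, which is null for the uniform
law but need not be for the Dirac law of `top`. -/
theorem ae_ne (β : ℝ) {i j : Fin n} (hi : i ≠ top) (hij : i ≠ j) :
    ∀ᵐ x ∂arrivalLaw top β, x i ≠ x j := by
  rw [arrivalLaw_eq]
  have h := measurePreserving_update_pi (timeLaw top β) i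
  have hm : MeasurableSet {x : Fin n → ℝ | x i = x j} :=
    measurableSet_eq_fun (measurable_pi_apply i) (measurable_pi_apply j)
  have hm' := h.measurable hm
  rw [ae_iff]
  simp only [ne_eq, not_not]
  rw [← h.measure_preimage hm.nullMeasurableSet, Measure.prod_apply_symm hm',
    lintegral_eq_zero_iff (measurable_measure_prodMk_right hm')]
  refine Filter.Eventually.of_forall fun x => ?_
  have : (fun t => (t, x)) ⁻¹' ((fun p : ℝ × (Fin n → ℝ) => Function.update p.2 i p.1) ⁻¹'
      {x | x i = x j}) = {x j} := by
    ext t; simp [Function.update_of_ne hij.symm]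
  simp only [this, timeLaw_of_ne hi, measure_singleton, Pi.zero_apply]

theorem ae_injective (β : ℝ) : ∀ᵐ x ∂arrivalLaw top β, Function.Injective x := by
  have h : ∀ i j : Fin n, ∀ᵐ x ∂arrivalLaw top β, i ≠ j → x i ≠ x j := by
    intro i j
    by_cases hij : i = j
    · simp [hij]
    · by_cases hi : i = top
      · have hj : j ≠ top := fun h => hij (hi.trans h.symm)
        filter_upwards [ae_ne top β hj (Ne.symm hij)] with x hx _ using hx.symm
      · filter_upwards [ae_ne top β hi hij] with x hx _ using hx
  filter_upwards [ae_all_iff.mpr fun i => ae_all_iff.mpr (h i)] with x hx i j hij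
  by_contra hne
  exact hx i j hne hij

variable (P vhat)

/-- The expected reward is bounded below by integrating a lower bound for the expected reward
given the arrival time `t` of candidate `i`. -/
theorem integral_le_expectedReward (hv : ∀ i, 0 ≤ v i) (β : ℝ) {i : Fin n} (hi : i ≠ top)
    {g : ℝ → ℝ} (hg : Integrable g unif) {S : Set ℝ} (hS : S.Countable)
    (h : ∀ t, 0 ≤ t → t ≤ 1 → t ∉ S → (∀ᵐ x ∂arrivalLaw top β,
        Function.Injective (Function.update x i t) ∧ Function.update x i t top = β) →
      g t ≤ ∫ x, avgReward P v vhat top (Function.update x i t) ∂arrivalLaw top β) :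
    ∫ t, g t ∂unif ≤ expectedReward P β v vhat top := by
  have hmp := measurePreserving_update_pi (timeLaw top β) i
  rw [expectedReward_eq P vhat top hv, arrivalLaw_eq, integral_pi_update (timeLaw top β) i
    (F := avgReward P v vhat top)
    (integrable_avgReward_comp P vhat top hv measurable_id), timeLaw_of_ne hi]
  rw [timeLaw_of_ne hi] at hmp
  refine integral_mono_ae hg ?_ ?_
  · exact (integrable_avgReward_comp P vhat top hv hmp.measurable).integral_prod_left
  · have h1 := Measure.ae_ae_of_ae_prod (hmp.quasiMeasurePreserving.ae
      ((ae_injective top β).and (ae_top_eq top β)))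
    have h2 : ∀ᵐ t ∂unif, t ∈ Set.Icc (0 : ℝ) 1 := ae_restrict_mem measurableSet_Icc
    filter_upwards [h1, h2, hS.ae_notMem unif] with t ht1 ht2 ht3
    exact h t ht2.1 ht2.2 ht3 ht1

/-- The shape covers all conditional bounds used below; the quadratic term arises from a blocker
arriving after the best candidate. -/
theorem integral_unif_eq {a b : ℝ} (h0 : 0 ≤ a) (hab : a ≤ b) (h1 : b ≤ 1) (g0 g1 c0 c1 : ℝ) :
    let g : ℝ → ℝ := fun t => if t < a then g0 else if t < b then g1 else
      c0 + c1 * ((1 - t) * (2 - t))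
    Integrable g unif ∧ ∫ t, g t ∂unif =
      g0 * a + g1 * (b - a) + c0 * (1 - b) + c1 * ((1 - b) ^ 2 / 2 + (1 - b) ^ 3 / 3) := by
  intro g
  have hcont : Continuous fun t : ℝ => c0 + c1 * ((1 - t) * (2 - t)) := by fun_prop
  have i0 : IntervalIntegrable g volume 0 a :=
    (intervalIntegrable_const (c := g0)).congr_uIoo (by
      intro t ht
      rw [Set.uIoo_of_le h0] at ht
      simp [g, ht.2])
  have i1 : IntervalIntegrable g volume a b :=
    (intervalIntegrable_const (c := g1)).congr_uIoo (by
      intro t ht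
      rw [Set.uIoo_of_le hab] at ht
      simp [g, ht.2, not_lt.mpr ht.1.le])
  have i2 : IntervalIntegrable g volume b 1 :=
    (hcont.intervalIntegrable b 1).congr_uIoo (by
      intro t ht
      rw [Set.uIoo_of_le h1] at ht
      simp [g, not_lt.mpr ht.1.le, not_lt.mpr (hab.trans ht.1.le)])
  have e0 : ∫ t in (0 : ℝ)..a, g t = g0 * a := by
    rw [intervalIntegral.integral_congr_Ioo_of_le h0 (g := fun _ => g0) (fun t ht => by
      simp [g, ht.2])]
    simp [mul_comm]
  have e1 : ∫ t in a..b, g t = g1 * (b - a) := by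
    rw [intervalIntegral.integral_congr_Ioo_of_le hab (g := fun _ => g1) (fun t ht => by
      simp [g, ht.2, not_lt.mpr ht.1.le])]
    simp [mul_comm]
  have e2 : ∫ t in b..1, g t = c0 * (1 - b) + c1 * ((1 - b) ^ 2 / 2 + (1 - b) ^ 3 / 3) := by
    rw [intervalIntegral.integral_congr_Ioo_of_le h1
      (g := fun t => c0 + c1 * ((1 - t) * (2 - t))) (fun t ht => by
        simp [g, not_lt.mpr ht.1.le, not_lt.mpr (hab.trans ht.1.le)])]
    have hd : ∀ t ∈ Set.uIcc b 1, HasDerivAt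
        (fun t : ℝ => c0 * t + c1 * (2 * t - 3 / 2 * t ^ 2 + t ^ 3 / 3))
        (c0 + c1 * ((1 - t) * (2 - t))) t := by
      intro t _
      have h := ((hasDerivAt_id t).const_mul c0).add ((((hasDerivAt_id t).const_mul 2).sub
        (((hasDerivAt_id t).pow 2).const_mul (3 / 2))).add
          (((hasDerivAt_id t).pow 3).div_const 3) |>.const_mul c1)
      refine h.congr_deriv ?_
      simp only [id_eq]
      push_cast
      ring
    rw [intervalIntegral.integral_eq_sub_of_hasDerivAt hd (hcont.intervalIntegrable b 1)]
    ring
  have i012 := (i0.trans i1).trans i2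
  have hint : Integrable g unif := by
    rw [unif, ← IntegrableOn, integrableOn_Icc_iff_integrableOn_Ioc]
    exact (intervalIntegrable_iff_integrableOn_Ioc_of_le zero_le_one).mp i012
  refine ⟨hint, ?_⟩
  rw [unif, integral_Icc_eq_integral_Ioc, ← intervalIntegral.integral_of_le zero_le_one,
    ← intervalIntegral.integral_add_adjacent_intervals (i0.trans i1) i2,
    ← intervalIntegral.integral_add_adjacent_intervals i0 i1, e0, e1, e2]
  ring

end Averages

/-! ### Arrival patterns that determine the hire -/

section Outcomes

variable {n : ℕ} {P : Params} {v vhat : Fin n → ℝ} {top i c : Fin n} {x : Fin n → ℝ} {u : ℝ}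

open Classical in
/-- The candidates other than the top predicted one and candidate `i`. -/
noncomputable def others (top i : Fin n) : Finset (Fin n) :=
  Finset.univ.filter fun j => j ≠ top ∧ j ≠ i

theorem mem_others {j : Fin n} : j ∈ others top i ↔ j ≠ top ∧ j ≠ i := by simp [others]

theorem run_eq_top_of_prediction (hx : Function.Injective x)
    (h : ∀ b, IsBad P v vhat b → x top < x b) : run P v vhat top x u = some top :=
  run_eq_some hx (hires_top_of_prediction h) fun _ hj =>
    not_hires_of_ne_top (fun h => by simp [h] at hj) (Or.inl fun b hb => hj.trans (h b hb))

theorem run_eq_top_of_first (hx : Function.Injective x) (hbad : IsBad P v vhat top)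
    (h : ∀ b, b ≠ top → IsBad P v vhat b → x top < x b) (hτ : P.τ < x top)
    (hrec : ∀ j, x j < x top → v j < v top) (hu : u < P.γ) :
    run P v vhat top x u = some top := by
  refine run_eq_some hx (hires_top_of_first hbad h hτ hrec hu) fun j hj => ?_
  refine not_hires_of_ne_top (fun h => by simp [h] at hj) (Or.inl fun b hb => ?_)
  by_cases hb' : b = top
  · rwa [hb']
  · exact hj.trans (h b hb' hb)

theorem early_or_blocked {s : Finset (Fin n)} {a b : ℝ} {j : Fin n}
    (h : x ∈ noRecord v s a b) (hj : j ∈ s) (hjb : x j < b) :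
    x j ≤ a ∨ ∃ k, x k < x j ∧ v j ≤ v k := by
  by_cases hja : x j ≤ a
  · exact Or.inl hja
  · obtain ⟨k, _, hk, hv⟩ := h j hj (not_le.mp hja).le hjb
    exact Or.inr ⟨k, hk.trans (not_le.mp hja), hv.le⟩

/-- Common frame for the patterns below. `top` is treated apart, since it alone can be hired in
Prediction mode and alone is subject to the seed. -/
theorem run_eq_best (hx : Function.Injective x) (hi : i ≠ top) (hmax : ∀ j, j ≠ i → v j < v i)
    (hτ : P.τ < x i) {b : Fin n} (hb : IsBad P v vhat b) (hbi : x b ≤ x i)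
    (hothers : ∀ j ∈ others top i, x j < x i →
      (∀ b, IsBad P v vhat b → x j < x b) ∨ x j ≤ P.τ ∨ ∃ k, x k < x j ∧ v j ≤ v k)
    (htop : x top < x i → (∃ b, IsBad P v vhat b ∧ x b ≤ x top) ∧
      ((∃ k, x k < x top ∧ v top ≤ v k) ∨ (P.γ ≤ u ∧ P.δ ≤ u) ∨
        (P.γ ≤ u ∧ ∀ c, c ≠ top → IsBad P v vhat c → x top < x c))) :
    run P v vhat top x u = some i := by
  have hne : ∀ j, x j < x i → j ≠ i := fun j hj h => by simp [h] at hj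
  refine run_eq_some hx (hires_of_ne_top hi hb hbi hτ fun j hj => hmax j (hne j hj)) ?_
  intro j hj
  by_cases hjt : j = top
  · subst hjt
    obtain ⟨⟨b, hb, hbt⟩, h⟩ := htop hj
    exact not_hires_top hb hbt h
  · exact not_hires_of_ne_top hjt (hothers j (mem_others.mpr ⟨hjt, hne j hj⟩) hj)

theorem run_eq_best_of_noRecord (hx : Function.Injective x) (hi : i ≠ top)
    (hmax : ∀ j, j ≠ i → v j < v i) (hτ : P.τ < x i) (hit : x i < x top)
    (hrec : x ∈ noRecord v (others top i) P.τ (x i))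
    (hbad : x ∈ badBefore (IsBad P v vhat) (others top i) (x i)) :
    run P v vhat top x u = some i := by
  obtain ⟨b, _, hb, hbi⟩ := hbad
  exact run_eq_best hx hi hmax hτ hb hbi.le
    (fun j hj hji => Or.inr (early_or_blocked hrec hj hji)) fun h => absurd h hit.not_gt

open Classical in
-- Every other bad candidate comes later, so `i` triggers the switch itself and is hired at once.
theorem run_eq_best_of_isBad (hx : Function.Injective x) (hi : i ≠ top)
    (hmax : ∀ j, j ≠ i → v j < v i) (hτ : P.τ < x i) (hit : x i < x top)
    (hbi : IsBad P v vhat i)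
    (hbad : x ∈ allAfter ((others top i).filter (IsBad P v vhat)) (x top)) :
    run P v vhat top x u = some i := by
  refine run_eq_best hx hi hmax hτ hbi le_rfl (fun j hj hji => Or.inl fun b hb => ?_)
    fun h => absurd h hit.not_gt
  by_cases h1 : b = i
  · rwa [h1]
  · by_cases h2 : b = top
    · rw [h2]; exact hji.trans hit
    · exact (hji.trans hit).trans (hbad b (by simp [mem_others, h1, h2, hb]))

open Classical in
-- The early best `c` blocks `top` and all arrivals between `τ` and `i`: whoever beats `c` also
-- beats `top`, hence lies in the filtered set and comes after `i`.
theorem run_eq_best_of_bestEarly (hx : Function.Injective x) (hi : i ≠ top)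
    (hmax : ∀ j, j ≠ i → v j < v i) (hτt : P.τ < x top) (hti : x top < x i)
    (hbest : x ∈ bestEarly v ((others top i).filter fun j => v top < v j) P.τ (x i))
    (hbad : x ∈ badBefore (IsBad P v vhat) (others top i) (x top)) :
    run P v vhat top x u = some i := by
  obtain ⟨b, _, hb, hbt⟩ := hbad
  obtain ⟨c, hc, hcτ, hcmax⟩ := hbest
  have hct := (Finset.mem_filter.mp hc).2
  refine run_eq_best hx hi hmax (hτt.trans hti) hb (hbt.trans hti).le (fun j hj hji => Or.inr ?_)
    fun _ => ⟨⟨b, hb, hbt.le⟩, Or.inl ⟨c, hcτ.trans hτt, hct.le⟩⟩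
  by_cases hjτ : x j ≤ P.τ
  · exact Or.inl hjτ
  · refine Or.inr ⟨c, hcτ.trans (not_le.mp hjτ), ?_⟩
    by_contra hv
    rw [not_le] at hv
    exact absurd (hcmax j (Finset.mem_filter.mpr ⟨hj, hct.trans hv⟩) hv) hji.not_gt

open Classical in
-- The seed rejects `top`, which nevertheless blocks the weaker candidates after it; those before it
-- and after `τ` are blocked by an arrival before `τ`.
theorem run_eq_best_of_allAfter (hx : Function.Injective x) (hi : i ≠ top)
    (hmax : ∀ j, j ≠ i → v j < v i) (hτt : P.τ < x top) (hti : x top < x i)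
    (hγδ : P.γ ≤ P.δ) (hu : P.δ ≤ u)
    (hall : x ∈ allAfter ((others top i).filter fun j => v top < v j) (x i))
    (hrec : x ∈ noRecord v ((others top i).filter fun j => ¬ v top < v j) P.τ (x top))
    (hbad : x ∈ badBefore (IsBad P v vhat) ((others top i).filter fun j => ¬ v top < v j)
      (x top)) :
    run P v vhat top x u = some i := by
  obtain ⟨b, _, hb, hbt⟩ := hbad
  refine run_eq_best hx hi hmax (hτt.trans hti) hb (hbt.trans hti).le (fun j hj hji => Or.inr ?_)
    fun _ => ⟨⟨b, hb, hbt.le⟩, Or.inr (Or.inl ⟨hγδ.trans hu, hu⟩)⟩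
  by_cases hvj : v top < v j
  · exact absurd (hall j (Finset.mem_filter.mpr ⟨hj, hvj⟩)) hji.not_gt
  · rcases lt_trichotomy (x j) (x top) with h | h | h
    · exact early_or_blocked hrec (Finset.mem_filter.mpr ⟨hj, hvj⟩) h
    · exact absurd (hx h) (mem_others.mp hj).1
    · exact Or.inr ⟨top, h, not_lt.mp hvj⟩

open Classical in
-- Until `top` arrives the mode is Prediction and nobody is hired; `top` switches it, is rejected by
-- the seed and blocks all others but `i`.
theorem run_eq_best_of_top_second (hx : Function.Injective x) (hi : i ≠ top)
    (hmax : ∀ j, j ≠ i → v j < v i) (hτt : P.τ < x top) (hti : x top < x i)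
    (hbt : IsBad P v vhat top) (hbi : ¬ IsBad P v vhat i)
    (htop : ∀ j ∈ others top i, v j ≤ v top) (hu : P.γ ≤ u)
    (hbad : x ∈ allAfter ((others top i).filter (IsBad P v vhat)) (x top)) :
    run P v vhat top x u = some i := by
  have hb' : ∀ c, c ≠ top → IsBad P v vhat c → x top < x c := by
    intro c hc hcb
    have hci : c ≠ i := fun h => hbi (h ▸ hcb)
    exact hbad c (by simp [mem_others, hc, hci, hcb])
  refine run_eq_best hx hi hmax (hτt.trans hti) hbt hti.le (fun j hj hji => ?_)
    fun _ => ⟨⟨top, hbt, le_rfl⟩, Or.inr (Or.inr ⟨hu, hb'⟩)⟩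
  rcases lt_trichotomy (x j) (x top) with h | h | h
  · refine Or.inl fun b hb => ?_
    by_cases hbt' : b = top
    · rwa [hbt']
    · exact h.trans (hb' b hbt' hb)
  · exact absurd (hx h) (mem_others.mp hj).1
  · exact Or.inr (Or.inr ⟨top, h, htop j hj⟩)

/-- A `c` before `τ` blocks everyone who matters whenever the switch happens; the bad `top`
guarantees the switch before `i`. -/
theorem run_eq_best_of_blocker_early (hx : Function.Injective x) (hi : i ≠ top)
    (hmax : ∀ j, j ≠ i → v j < v i) (hτt : P.τ < x top) (hti : x top < x i)
    (hbt : IsBad P v vhat top) (hct : v top < v c)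
    (hcmax : ∀ j ∈ others top i, v j ≤ v c) (hcτ : x c < P.τ) :
    run P v vhat top x u = some i := by
  refine run_eq_best hx hi hmax (hτt.trans hti) hbt hti.le (fun j hj hji => Or.inr ?_)
    fun _ => ⟨⟨top, hbt, le_rfl⟩, Or.inl ⟨c, hcτ.trans hτt, hct.le⟩⟩
  by_cases hjτ : x j ≤ P.τ
  · exact Or.inl hjτ
  · exact Or.inr ⟨c, hcτ.trans (not_le.mp hjτ), hcmax j hj⟩

open Classical in
-- Before `top` the mode is Prediction, so `c` needs to precede only `top`, not `τ`.
theorem run_eq_best_of_blocker (hx : Function.Injective x) (hi : i ≠ top)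
    (hmax : ∀ j, j ≠ i → v j < v i) (hτt : P.τ < x top) (hti : x top < x i)
    (hbt : IsBad P v vhat top) (hbi : ¬ IsBad P v vhat i) (hct : v top < v c)
    (hcmax : ∀ j ∈ others top i, v j ≤ v c) (hc : x c < x top)
    (hbad : x ∈ allAfter ((others top i).filter (IsBad P v vhat)) (x top)) :
    run P v vhat top x u = some i := by
  refine run_eq_best hx hi hmax (hτt.trans hti) hbt hti.le (fun j hj hji => ?_)
    fun _ => ⟨⟨top, hbt, le_rfl⟩, Or.inl ⟨c, hc, hct.le⟩⟩
  rcases lt_trichotomy (x j) (x top) with h | h | h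
  · refine Or.inl fun b hb => ?_
    by_cases hbt' : b = top
    · rwa [hbt']
    · have hbi' : b ≠ i := fun h => hbi (h ▸ hb)
      exact h.trans (hbad b (by simp [mem_others, hbt', hbi', hb]))
  · exact absurd (hx h) (mem_others.mp hj).1
  · exact Or.inr (Or.inr ⟨c, hc.trans h, hcmax j hj⟩)

/-- Here `c`, the only other candidate that may be bad, comes after `i`. The switch happens at
`top`, so only records between `top` and `i` could interfere. -/
theorem run_eq_best_of_blocker_late (hx : Function.Injective x) (hi : i ≠ top)
    (hmax : ∀ j, j ≠ i → v j < v i) (hτt : P.τ < x top) (hti : x top < x i)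
    (hbt : IsBad P v vhat top) (hbi : ¬ IsBad P v vhat i)
    (hgood : ∀ j ∈ (others top i).erase c, ¬ IsBad P v vhat j) (hc : x i < x c)
    (hrec : x ∈ noRecord v ((others top i).erase c) (x top) (x i)) (hu : P.γ ≤ u) :
    run P v vhat top x u = some i := by
  have hb' : ∀ b, b ≠ top → IsBad P v vhat b → x top < x b := by
    intro b hb hbb
    have hbi' : b ≠ i := fun h => hbi (h ▸ hbb)
    have : b = c := by
      by_contra hbc
      exact hgood b (Finset.mem_erase.mpr ⟨hbc, mem_others.mpr ⟨hb, hbi'⟩⟩) hbb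
    rw [this]; exact hti.trans hc
  refine run_eq_best hx hi hmax (hτt.trans hti) hbt hti.le (fun j hj hji => ?_)
    fun _ => ⟨⟨top, hbt, le_rfl⟩, Or.inr (Or.inr ⟨hu, hb'⟩)⟩
  have hjc : j ≠ c := fun h => absurd hji (h ▸ hc.not_gt)
  rcases early_or_blocked hrec (Finset.mem_erase.mpr ⟨hjc, hj⟩) hji with h | h
  · have h' : x j < x top := lt_of_le_of_ne h fun h => (mem_others.mp hj).1 (hx h)
    refine Or.inl fun b hb => ?_
    by_cases hbt' : b = top
    · rwa [hbt']
    · exact h'.trans (hb' b hbt' hb)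
  · exact Or.inr (Or.inr h)

open Classical in
theorem run_eq_top_of_allAfter (hx : Function.Injective x) (hmax : ∀ j, j ≠ top → v j < v top)
    (hτt : P.τ < x top) (hu : u < P.γ)
    (hbad : x ∈ allAfter ((others top top).filter (IsBad P v vhat)) (x top)) :
    run P v vhat top x u = some top := by
  have hb' : ∀ b, b ≠ top → IsBad P v vhat b → x top < x b := fun b hb hbb =>
    hbad b (by simp [mem_others, hb, hbb])
  by_cases hbt : IsBad P v vhat top
  · exact run_eq_top_of_first hx hbt hb' hτt
      (fun j hj => hmax j fun h => by simp [h] at hj) hu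
  · exact run_eq_top_of_prediction hx fun b hb => hb' b (fun h => hbt (h ▸ hb)) hb

theorem run_eq_top_of_noRecord (hx : Function.Injective x)
    (hmax : ∀ j, j ≠ top → v j < v top) (hτt : P.τ < x top) (hu : u < P.δ)
    (hrec : x ∈ noRecord v (others top top) P.τ (x top))
    (hbad : x ∈ badBefore (IsBad P v vhat) (others top top) (x top)) :
    run P v vhat top x u = some top := by
  have hne : ∀ j, x j < x top → j ≠ top := fun j hj h => by simp [h] at hj
  obtain ⟨b, _, hb, hbt⟩ := hbad
  refine run_eq_some hx (hires_top_of_later hb hbt hτt (fun j hj => hmax j (hne j hj)) hu) ?_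
  intro j hj
  exact not_hires_of_ne_top (hne j hj)
    (Or.inr (early_or_blocked hrec (mem_others.mpr ⟨hne j hj, hne j hj⟩) hj))

end Outcomes

/-! ### Bounds without a blocker -/

section Cases

/-- The parameters of the chosen order algorithm. -/
noncomputable def stdParams : Params := { θ := 0.58, τ := 0.37, γ := 0.27, δ := 0.46 }

variable {n : ℕ} {v vhat : Fin n → ℝ} {top i : Fin n}

theorem self_notMem_others : i ∉ others top i := by simp [mem_others]

theorem timeLaw_of_mem_others {β : ℝ} {j : Fin n} (hj : j ∈ others top i) :
    timeLaw top β j = unif := timeLaw_of_ne (mem_others.mp hj).1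

variable (v vhat top i) in
open Classical in
/-- The other candidates with a prediction error above the threshold. -/
noncomputable def badOthers : Finset (Fin n) :=
  (others top i).filter (IsBad stdParams v vhat)

theorem mem_badOthers {j : Fin n} :
    j ∈ badOthers v vhat top i ↔ (j ≠ top ∧ j ≠ i) ∧ IsBad stdParams v vhat j := by
  simp [badOthers, mem_others]

theorem self_notMem_badOthers : i ∉ badOthers v vhat top i := by simp [mem_badOthers]

theorem timeLaw_of_mem_badOthers {β : ℝ} {j : Fin n} (hj : j ∈ badOthers v vhat top i) :
    timeLaw top β j = unif := timeLaw_of_ne (mem_badOthers.mp hj).1.1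

theorem disjoint_badBefore_allAfter {s : Finset (Fin n)} {b β : ℝ} (hb : b ≤ β)
    (hs : s ⊆ others top i) :
    Disjoint (badBefore (IsBad stdParams v vhat) s b) (allAfter (badOthers v vhat top i) β) := by
  rw [Set.disjoint_left]
  rintro x ⟨j, hj, hbj, hx⟩ hx'
  have := hx' j (mem_badOthers.mpr ⟨mem_others.mp (hs hj), hbj⟩)
  linarith

theorem measureReal_allAfter_badOthers : (arrivalLaw top 0.64).real
    (allAfter (badOthers v vhat top i) 0.64) = 0.36 ^ (badOthers v vhat top i).card := by
  rw [arrivalLaw_eq, measureReal_allAfter _ _ (fun j hj => timeLaw_of_mem_badOthers hj)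
    (by norm_num) (by norm_num)]
  norm_num

/-- A bad arrival before 0.64 without a record in between 0.37 and 0.64 leaves the hiring
probability 0.46, and 0.46·0.37/0.64 = 0.2659375; in late runs the probability is at least 0.27. -/
theorem le_expectedReward_of_top_best (hv : ∀ i, 0 ≤ v i) (hinj : Function.Injective v)
    (hmax : ∀ j, j ≠ top → v j < v top) :
    0.2659 * v top ≤ expectedReward stdParams 0.64 v vhat top := by
  classical
  have hrun := (ae_injective top 0.64).and (ae_top_eq top 0.64)
  have h := sum_le_integral_of_le_on (ν := arrivalLaw top 0.64)
    (integrable_avgReward_comp stdParams vhat top hv measurable_id)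
    (fun x => avgReward_nonneg stdParams vhat top hv _)
    (A := noRecord v (others top top) 0.37 0.64 ∩
      {x | False ∨ x ∈ badBefore (IsBad stdParams v vhat) (others top top) 0.64})
    (B := allAfter (badOthers v vhat top top) 0.64) (C := ∅)
    ((measurableSet_noRecord _ _ _ _).inter
      ((MeasurableSet.const _).union (measurableSet_badBefore _ _ _)))
    (measurableSet_allAfter _ _) MeasurableSet.empty
    (a := 0.46 * v top) (b := 0.27 * v top) (c := 0)
    (by
      refine Disjoint.mono_left ?_ (disjoint_badBefore_allAfter le_rfl subset_rfl)
      rintro x ⟨_, h | h⟩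
      · exact h.elim
      · exact h)
    (by simp) (by simp)
    (by
      filter_upwards [hrun] with x hx hxA
      rcases hxA with ⟨hx1, h | hx2⟩
      · exact h.elim
      · exact le_avgReward_of_lt hv (by norm_num) (by norm_num) fun u hu =>
          run_eq_top_of_noRecord (P := stdParams) hx.1 hmax (by rw [id, hx.2, stdParams]; norm_num)
            hu (by rw [id, hx.2]; exact hx1) (by rw [id, hx.2]; exact hx2))
    (by
      filter_upwards [hrun] with x hx hxB
      exact le_avgReward_of_lt hv (by norm_num) (by norm_num) fun u hu =>
          run_eq_top_of_allAfter (P := stdParams) hx.1 hmax (by rw [id, hx.2, stdParams]; norm_num)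
            hu (by rw [id, hx.2]; exact hxB))
    (by simp)
  have hE := le_measureReal_noRecord (timeLaw top 0.64) v (IsBad stdParams v vhat) False
    (others top top) (fun j hj => timeLaw_of_mem_others hj) hinj (a := 0.37) (b := 0.64)
    (by norm_num) (by norm_num) (by norm_num) (by norm_num)
  rw [expectedReward_eq stdParams vhat top hv]
  refine le_trans ?_ h
  rw [measureReal_allAfter_badOthers]
  rw [← arrivalLaw_eq, if_neg (by simp)] at hE
  change _ * (1 - 1 * _ ^ (badOthers v vhat top top).card) ≤ _ at hE
  norm_num at hE ⊢
  have h0 := hv top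
  have hp : (0 : ℝ) ≤ (9 / 25) ^ (badOthers v vhat top top).card := by positivity
  nlinarith [mul_le_mul_of_nonneg_left hE h0, mul_nonneg h0 hp]

variable (v vhat top i) in
/-- The expected reward given that candidate `i` arrives at time `t`. -/
noncomputable def condReward (t : ℝ) : ℝ :=
  ∫ x, avgReward stdParams v vhat top (Function.update x i t) ∂arrivalLaw top 0.64

variable (top i) in
/-- Almost surely, the arrival times are distinct if candidate `i` arrives at time `t`. -/
def GoodTime (t : ℝ) : Prop :=
  ∀ᵐ x ∂arrivalLaw top 0.64,
    Function.Injective (Function.update x i t) ∧ Function.update x i t top = 0.64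

theorem measurable_update_const (t : ℝ) :
    Measurable fun x : Fin n → ℝ => Function.update x i t := by fun_prop

theorem le_condReward (hv : ∀ i, 0 ≤ v i) {t : ℝ} (hgood : GoodTime top i t)
    {A B C : Set (Fin n → ℝ)} (hA : MeasurableSet A) (hB : MeasurableSet B) (hC : MeasurableSet C)
    (hAB : Disjoint A B) (hAC : Disjoint A C) (hBC : Disjoint B C) {a b c : ℝ}
    (ha : ∀ x, Function.Injective (Function.update x i t) → Function.update x i t top = 0.64 →
      x ∈ A → a ≤ avgReward stdParams v vhat top (Function.update x i t))
    (hb : ∀ x, Function.Injective (Function.update x i t) → Function.update x i t top = 0.64 →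
      x ∈ B → b ≤ avgReward stdParams v vhat top (Function.update x i t))
    (hc : ∀ x, Function.Injective (Function.update x i t) → Function.update x i t top = 0.64 →
      x ∈ C → c ≤ avgReward stdParams v vhat top (Function.update x i t)) :
    a * (arrivalLaw top 0.64).real A + b * (arrivalLaw top 0.64).real B +
      c * (arrivalLaw top 0.64).real C ≤ condReward v vhat top i t := by
  refine sum_le_integral_of_le_on (ν := arrivalLaw top 0.64)
    (integrable_avgReward_comp stdParams vhat top hv (measurable_update_const t))
    (fun x => avgReward_nonneg stdParams vhat top hv _) hA hB hC hAB hAC hBC ?_ ?_ ?_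
  · filter_upwards [hgood] with x hx using ha x hx.1 hx.2
  · filter_upwards [hgood] with x hx using hb x hx.1 hx.2
  · filter_upwards [hgood] with x hx using hc x hx.1 hx.2

/-- Lower bounds for the expected reward given the arrival time of candidate `i`, for the three
ranges of this time, yield one for the expected reward. -/
theorem le_expectedReward_of_condReward (hv : ∀ i, 0 ≤ v i) (hi : i ≠ top) {g0 g1 c0 c1 : ℝ}
    (h0 : ∀ t, 0 ≤ t → t < 0.37 → GoodTime top i t → g0 ≤ condReward v vhat top i t)
    (h1 : ∀ t, 0.37 < t → t < 0.64 → GoodTime top i t → g1 ≤ condReward v vhat top i t)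
    (h2 : ∀ t, 0.64 < t → t ≤ 1 → GoodTime top i t →
      c0 + c1 * ((1 - t) * (2 - t)) ≤ condReward v vhat top i t) :
    g0 * 0.37 + g1 * 0.27 + c0 * 0.36 + c1 * 0.080352 ≤
      expectedReward stdParams 0.64 v vhat top := by
  -- The constant 0.080352 = 0.36²/2 + 0.36³/3 is the integral of (1-t)(2-t) over [0.64, 1].
  obtain ⟨hg, hgi⟩ := integral_unif_eq (a := 0.37) (b := 0.64) (by norm_num) (by norm_num)
    (by norm_num) g0 g1 c0 c1
  have h := integral_le_expectedReward stdParams vhat top hv 0.64 hi hg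
    (S := {0.37, 0.64}) (Set.Finite.countable (by simp)) (by
      intro t ht0 ht1 htS hgood
      simp only [Set.mem_insert_iff, Set.mem_singleton_iff, not_or] at htS
      change _ ≤ condReward v vhat top i t
      split_ifs with ha hb
      · exact h0 t ht0 ha hgood
      · exact h1 t (lt_of_le_of_ne (not_lt.mp ha) (Ne.symm htS.1)) hb hgood
      · exact h2 t (lt_of_le_of_ne (not_lt.mp hb) (Ne.symm htS.2)) ht1 hgood)
  rw [hgi] at h
  refine le_of_eq_of_le ?_ h
  norm_num

/-- `c` is a lower bound for the reward if candidate `i` arrives at time `t` and all other bad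
candidates arrive after the top predicted one. -/
def RewardIfLate (v vhat : Fin n → ℝ) (top i : Fin n) (t c : ℝ) : Prop :=
  ∀ y, Function.Injective y → y top = 0.64 → y i = t →
    y ∈ allAfter (badOthers v vhat top i) 0.64 → c ≤ avgReward stdParams v vhat top y

theorem rewardIfLate_zero (hv : ∀ i, 0 ≤ v i) (t : ℝ) : RewardIfLate v vhat top i t 0 :=
  fun y _ _ _ _ => avgReward_nonneg stdParams vhat top hv y

theorem le_condReward_any (hv : ∀ i, 0 ≤ v i) {t c : ℝ} (hgood : GoodTime top i t)
    (hc : RewardIfLate v vhat top i t c) :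
    c * 0.36 ^ (badOthers v vhat top i).card ≤ condReward v vhat top i t := by
  have h := le_condReward (vhat := vhat) hv hgood
    (measurableSet_allAfter (badOthers v vhat top i) 0.64) MeasurableSet.empty MeasurableSet.empty
    (by simp) (by simp) (by simp) (a := c) (b := 0) (c := 0)
    (fun x hx hx' hxA => hc _ hx hx' (by simp)
      ((update_mem_allAfter self_notMem_badOthers x t).mpr hxA)) (by simp) (by simp)
  rw [measureReal_allAfter_badOthers] at h
  linarith

theorem le_condReward_before (hv : ∀ i, 0 ≤ v i) (hinj : Function.Injective v) (hi : i ≠ top)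
    (hmax : ∀ j, j ≠ i → v j < v i) {t c : ℝ} (ht : 0.37 < t) (ht' : t < 0.64)
    (hgood : GoodTime top i t) (hc : RewardIfLate v vhat top i t c) :
    0.37 * (∑ m ∈ Finset.range (badOthers v vhat top i).card, (1 - t) ^ m) * v i +
      c * 0.36 ^ (badOthers v vhat top i).card ≤ condReward v vhat top i t := by
  classical
  have h := le_condReward (vhat := vhat) hv hgood
    (A := noRecord v (others top i) 0.37 t ∩
      {x | False ∨ x ∈ badBefore (IsBad stdParams v vhat) (others top i) t})
    ((measurableSet_noRecord _ _ _ _).inter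
      ((MeasurableSet.const _).union (measurableSet_badBefore _ _ _)))
    (measurableSet_allAfter (badOthers v vhat top i) 0.64) MeasurableSet.empty
    (by
      refine Disjoint.mono_left ?_ (disjoint_badBefore_allAfter ht'.le subset_rfl)
      rintro x ⟨_, h | h⟩
      · exact h.elim
      · exact h)
    (by simp) (by simp) (a := v i) (b := c) (c := 0)
    (by
      rintro x hx hx' ⟨hx1, hF | hx2⟩
      · exact hF.elim
      · have hxi : Function.update x i t i = t := by simp
        exact le_avgReward_of_run hv fun u =>
          run_eq_best_of_noRecord (P := stdParams) hx hi hmax (by rw [hxi]; exact ht)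
            (by rw [hxi, hx']; exact ht')
            (by rw [hxi]; exact (update_mem_noRecord self_notMem_others x t).mpr hx1)
            (by rw [hxi]; exact (update_mem_badBefore self_notMem_others x t).mpr hx2))
    (fun x hx hx' hxA => hc _ hx hx' (by simp)
      ((update_mem_allAfter self_notMem_badOthers x t).mpr hxA)) (by simp)
  have hE := le_measureReal_noRecord (timeLaw top 0.64) v (IsBad stdParams v vhat) False
    (others top i) (fun j hj => timeLaw_of_mem_others hj) hinj (a := 0.37) (b := t)
    (by norm_num) ht.le (by linarith) (by linarith)
  rw [measureReal_allAfter_badOthers] at h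
  rw [← arrivalLaw_eq, if_neg (by simp)] at hE
  change _ * (1 - 1 * _ ^ (badOthers v vhat top i).card) ≤ _ at hE
  have hgeom := mul_neg_geom_sum (1 - t) (badOthers v vhat top i).card
  have ht0 : t ≠ 0 := by linarith
  -- As a geometric sum the bound is termwise decreasing in `t` and free of division.
  have hEq : 0.37 / t * (1 - 1 * (1 - t) ^ (badOthers v vhat top i).card) =
      0.37 * ∑ m ∈ Finset.range (badOthers v vhat top i).card, (1 - t) ^ m := by
    rw [one_mul, ← hgeom]; field_simp; ring
  rw [hEq] at hE
  have := mul_le_mul_of_nonneg_left hE (hv i)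
  linarith

/-- The danger is `top` being hired at 0.64. Either an early better candidate blocks it, or none
better arrives until `t` and the seed rejects `top` with probability 0.54. The constant is
0.54·0.37/0.64. -/
theorem le_condReward_after (hv : ∀ i, 0 ≤ v i) (hinj : Function.Injective v) (hi : i ≠ top)
    (hmax : ∀ j, j ≠ i → v j < v i) {t c : ℝ} (ht : 0.64 < t) (ht' : t ≤ 1)
    (hgood : GoodTime top i t) (hc : RewardIfLate v vhat top i t c) :
    0.3121875 * (1 - 0.36 ^ (badOthers v vhat top i).card) * v i +
      c * 0.36 ^ (badOthers v vhat top i).card ≤ condReward v vhat top i t := by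
  classical
  set U := (others top i).filter fun j => v top < v j with hU
  set L := (others top i).filter fun j => ¬ v top < v j with hL
  have hLU : L ∪ U = others top i := by
    rw [Finset.union_comm]; exact Finset.filter_union_filter_not_eq _ _
  have hLs : L ⊆ others top i := Finset.filter_subset _ _
  have hUs : U ⊆ others top i := Finset.filter_subset _ _
  set bad := IsBad stdParams v vhat with hbad
  have hmW : ∀ (s : Finset (Fin n)) b, MeasurableSet {x | False ∨ x ∈ badBefore bad s b} :=
    fun s b => (MeasurableSet.const _).union (measurableSet_badBefore _ _ _)
  set B := noRecord v L 0.37 0.64 ∩ {x | False ∨ x ∈ badBefore bad L 0.64} with hB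
  have hBm : MeasurableSet B := (measurableSet_noRecord _ _ _ _).inter (hmW _ _)
  have hxi : ∀ x : Fin n → ℝ, Function.update x i t i = t := fun x => by simp
  have h := le_condReward (vhat := vhat) hv hgood
    (A := bestEarly v U 0.37 t ∩ {x | False ∨ x ∈ badBefore bad (others top i) 0.64})
    (B := allAfter U t ∩ B)
    ((measurableSet_bestEarly _ _ _ _).inter (hmW _ _))
    ((measurableSet_allAfter _ _).inter hBm)
    (measurableSet_allAfter (badOthers v vhat top i) 0.64)
    (by
      rw [Set.disjoint_left]
      rintro x ⟨⟨d, hd, hdx, _⟩, _⟩ ⟨hx, _⟩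
      have := hx d hd
      linarith)
    (by
      refine Disjoint.mono_left ?_ (disjoint_badBefore_allAfter le_rfl subset_rfl)
      rintro x ⟨_, h | h⟩
      · exact h.elim
      · exact h)
    (by
      refine Disjoint.mono_left ?_ (disjoint_badBefore_allAfter le_rfl hLs)
      rintro x ⟨_, _, h | h⟩
      · exact h.elim
      · exact h)
    (a := v i) (b := (1 - 0.46) * v i) (c := c)
    (by
      rintro x hx hx' ⟨hx1, hF | hx2⟩
      · exact hF.elim
      · exact le_avgReward_of_run hv fun u =>
          run_eq_best_of_bestEarly (P := stdParams) hx hi hmax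
            (by rw [hx', stdParams]; norm_num) (by rw [hxi, hx']; exact ht)
            (by rw [hxi]; exact
              (update_mem_bestEarly (fun h => self_notMem_others (hUs h)) x t).mpr hx1)
            (by rw [hx']; exact (update_mem_badBefore self_notMem_others x t).mpr hx2))
    (by
      rintro x hx hx' ⟨hx0, hx1, hF | hx2⟩
      · exact hF.elim
      · exact le_avgReward_of_ge hv (by norm_num) (by norm_num) fun u hu =>
          run_eq_best_of_allAfter (P := stdParams) hx hi hmax
            (by rw [hx', stdParams]; norm_num) (by rw [hxi, hx']; exact ht)
            (by rw [stdParams]; norm_num) hu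
            (by rw [hxi]; exact
              (update_mem_allAfter (fun h => self_notMem_others (hUs h)) x t).mpr hx0)
            (by rw [hx']; exact
              (update_mem_noRecord (fun h => self_notMem_others (hLs h)) x t).mpr hx1)
            (by rw [hx']; exact
              (update_mem_badBefore (fun h => self_notMem_others (hLs h)) x t).mpr hx2))
    (fun x hx hx' hxA => hc _ hx hx' (by simp)
      ((update_mem_allAfter self_notMem_badOthers x t).mpr hxA))
  have hlaw : ∀ j ∈ others top i, timeLaw top 0.64 j = unif := fun j hj =>
    timeLaw_of_mem_others hj
  have hE := le_measureReal_noRecord (timeLaw top 0.64) v bad False L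
    (fun j hj => hlaw j (hLs hj)) hinj (a := 0.37) (b := 0.64)
    (by norm_num) (by norm_num) (by norm_num) (by norm_num)
  -- The weaker candidates `L` alone dictate `z = 0.54 * 0.37 / 0.64`; the condition `z * t ≤ 0.37`
  -- then has room to spare.
  have hD := le_bestEarly_add_allAfter (timeLaw top 0.64) v bad False L U
    (Finset.disjoint_filter_filter_not _ _ _).symm
    (fun j hj => hlaw j (hLs hj)) (fun j hj => hlaw j (hUs hj))
    (a := 0.37) (b := t) (β := 0.64) (z := 0.3121875) (w := 0.54)
    (by norm_num) (by norm_num) ht.le ht' (by norm_num) (by linarith) hBm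
    (fun j hj x s => and_congr (update_mem_noRecord hj x s)
      (or_congr Iff.rfl (update_mem_badBefore hj x s)))
    (by
      refine le_of_eq_of_le ?_ (mul_le_mul_of_nonneg_left hE (by norm_num : (0 : ℝ) ≤ 0.54))
      rw [if_neg (by simp)]
      ring)
  rw [measureReal_allAfter_badOthers] at h
  rw [← arrivalLaw_eq, if_neg (by simp), hLU] at hD
  change _ * (1 - 1 * _ ^ (badOthers v vhat top i).card) ≤ _ at hD
  have h064 : (1 : ℝ) - 0.64 = 0.36 := by norm_num
  rw [h064] at hD
  have := mul_le_mul_of_nonneg_left hD (hv i)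
  refine le_trans ?_ h
  linarith

/-- The reward from runs in which some bad candidate arrives before the top predicted one,
combined with lower bounds for the reward in all other runs. -/
theorem le_expectedReward_of_rewardIfLate (hv : ∀ i, 0 ≤ v i) (hinj : Function.Injective v)
    (hi : i ≠ top) (hmax : ∀ j, j ≠ i → v j < v i) {c0 c1 c2 : ℝ}
    (h0 : ∀ t, 0 ≤ t → t < 0.37 → RewardIfLate v vhat top i t c0)
    (h1 : ∀ t, 0.37 < t → t < 0.64 → RewardIfLate v vhat top i t c1)
    (h2 : ∀ t, 0.64 < t → t ≤ 1 → RewardIfLate v vhat top i t c2) :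
    0.268 * (1 - 0.36 ^ (badOthers v vhat top i).card) * v i +
      (c0 * 0.37 + c1 * 0.27 + c2 * 0.36) * 0.36 ^ (badOthers v vhat top i).card ≤
      expectedReward stdParams 0.64 v vhat top := by
  set k := (badOthers v vhat top i).card with hk
  have hp1 : (0.36 : ℝ) ^ k ≤ 1 := pow_le_one₀ (by norm_num) (by norm_num)
  have h := le_expectedReward_of_condReward (vhat := vhat) hv hi (g0 := c0 * 0.36 ^ k)
    (g1 := 0.578125 * (1 - 0.36 ^ k) * v i + c1 * 0.36 ^ k)
    (c0 := 0.3121875 * (1 - 0.36 ^ k) * v i + c2 * 0.36 ^ k) (c1 := 0)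
    (fun t ht ht' hg => le_condReward_any hv hg (h0 t ht ht'))
    (fun t ht ht' hg => by
      refine le_trans ?_ (le_condReward_before hv hinj hi hmax ht ht' hg (h1 t ht ht'))
      -- Since `1 - t ≥ 0.36`, the sum is at least (1-0.36^k)/0.64, and 0.37/0.64 = 0.578125.
      have hs : 0.578125 * (1 - 0.36 ^ k) ≤ 0.37 * ∑ m ∈ Finset.range k, (1 - t) ^ m := by
        rw [← mul_neg_geom_sum (0.36 : ℝ) k]
        have : ∑ m ∈ Finset.range k, (0.36 : ℝ) ^ m ≤ ∑ m ∈ Finset.range k, (1 - t) ^ m :=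
          Finset.sum_le_sum fun m _ => pow_le_pow_left₀ (by norm_num) (by linarith) m
        generalize ∑ m ∈ Finset.range k, (0.36 : ℝ) ^ m = q at *
        linarith
      have := mul_le_mul_of_nonneg_right hs (hv i)
      linarith)
    (fun t ht ht' hg => by
      have := le_condReward_after hv hinj hi hmax ht ht' hg (h2 t ht ht')
      linarith)
  -- The factor 0.268 rounds down 0.578125·0.27 + 0.3121875·0.36 = 0.26848125.
  have h3 : 0 ≤ (1 - (0.36 : ℝ) ^ k) * v i := mul_nonneg (by linarith) (hv i)
  simp only [zero_mul, add_zero] at h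
  clear_value k
  generalize (0.36 : ℝ) ^ k = p at *
  linarith

theorem le_expectedReward_of_isBad_best (hv : ∀ i, 0 ≤ v i) (hinj : Function.Injective v)
    (hi : i ≠ top) (hmax : ∀ j, j ≠ i → v j < v i) (hbi : IsBad stdParams v vhat i) :
    0.2659 * v i ≤ expectedReward stdParams 0.64 v vhat top := by
  have h := le_expectedReward_of_rewardIfLate (vhat := vhat) (c0 := 0) (c1 := v i) (c2 := 0)
    hv hinj hi hmax (fun t _ _ => rewardIfLate_zero hv t)
    (fun t ht ht' y hy hyt hyi hyA => le_avgReward_of_run hv fun u =>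
      run_eq_best_of_isBad (P := stdParams) hy hi hmax (by rw [hyi]; exact ht)
        (by rw [hyi, hyt]; exact ht') hbi (by rw [hyt]; exact hyA))
    (fun t _ _ => rewardIfLate_zero hv t)
  have hp1 : (0.36 : ℝ) ^ (badOthers v vhat top i).card ≤ 1 :=
    pow_le_one₀ (by norm_num) (by norm_num)
  have hp0 : 0 ≤ (0.36 : ℝ) ^ (badOthers v vhat top i).card := by positivity
  have h1 := mul_nonneg (hv i) hp0
  have h2 := hv i
  linarith

theorem le_expectedReward_of_good (hv : ∀ i, 0 ≤ v i) (hinj : Function.Injective v)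
    (hi : i ≠ top) (hmax : ∀ j, j ≠ i → v j < v i) (hbi : ¬ IsBad stdParams v vhat i)
    (hbt : ¬ IsBad stdParams v vhat top) (hvt : 42 / 158 * v i ≤ v top) :
    42 / 158 * v i ≤ expectedReward stdParams 0.64 v vhat top := by
  have hlate : ∀ t, RewardIfLate v vhat top i t (v top) := by
    intro t y hy hyt hyi hyA
    refine le_avgReward_of_run hv fun u => run_eq_top_of_prediction (P := stdParams) hy ?_
    intro b hb
    rw [hyt]
    refine hyA b ?_
    have h1 : b ≠ top := fun h => hbt (h ▸ hb)
    have h2 : b ≠ i := fun h => hbi (h ▸ hb)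
    exact mem_badOthers.mpr ⟨⟨h1, h2⟩, hb⟩
  have h := le_expectedReward_of_rewardIfLate (vhat := vhat) hv hinj hi hmax
    (fun t _ _ => hlate t) (fun t _ _ => hlate t) (fun t _ _ => hlate t)
  have hp1 : (0.36 : ℝ) ^ (badOthers v vhat top i).card ≤ 1 :=
    pow_le_one₀ (by norm_num) (by norm_num)
  have hp0 : 0 ≤ (0.36 : ℝ) ^ (badOthers v vhat top i).card := by positivity
  have h1 := mul_le_mul_of_nonneg_right hvt hp0
  have h2 := mul_nonneg (hv i) (sub_nonneg.mpr hp1)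
  linarith

/-- The tight case: 0.73·0.36 = 0.2628 barely exceeds 0.262. For larger ρ the value of `top` helps,
as 0.36 (0.27ρ + 0.73) ≥ ρ for ρ ≤ 42/158. -/
theorem le_expectedReward_of_top_second (hv : ∀ i, 0 ≤ v i) (hinj : Function.Injective v)
    (hi : i ≠ top) (hmax : ∀ j, j ≠ i → v j < v i) (hbi : ¬ IsBad stdParams v vhat i)
    (hbt : IsBad stdParams v vhat top) (htop : ∀ j ∈ others top i, v j ≤ v top) {ρ : ℝ}
    (hρ : ρ ≤ 42 / 158) (hvt : ρ ≤ 0.262 ∨ ρ * v i ≤ v top) :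
    ρ * v i ≤ expectedReward stdParams 0.64 v vhat top := by
  have h := le_expectedReward_of_rewardIfLate (vhat := vhat) (c0 := 0) (c1 := 0)
    (c2 := 0.27 * v top + (1 - 0.27) * v i)
    hv hinj hi hmax (fun t _ _ => rewardIfLate_zero hv t)
    (fun t _ _ => rewardIfLate_zero hv t)
    (fun t ht ht' y hy hyt hyi hyA => le_avgReward hv (by norm_num) (by norm_num)
      (fun u hu => by
        rw [run_eq_top_of_first (P := stdParams) hy hbt
          (fun b hb hbb => ?_) (by rw [hyt, stdParams]; norm_num) (fun j hj => ?_) hu]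
        · exact le_rfl
        · have h2 : b ≠ i := fun h => hbi (h ▸ hbb)
          rw [hyt]
          exact hyA b (mem_badOthers.mpr ⟨⟨hb, h2⟩, hbb⟩)
        · have hjt : j ≠ top := fun h => by simp [h] at hj
          have hji : j ≠ i := fun h => by
            rw [h, hyi, hyt] at hj; linarith
          exact lt_of_le_of_ne (htop j (mem_others.mpr ⟨hjt, hji⟩)) fun h => hjt (hinj h))
      (fun u hu => by
        rw [run_eq_best_of_top_second (P := stdParams) hy hi hmax
          (by rw [hyt, stdParams]; norm_num) (by rw [hyt, hyi]; exact ht) hbt hbi htop hu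
          (by rw [hyt]; exact hyA)]
        exact le_rfl))
  have hp1 : (0.36 : ℝ) ^ (badOthers v vhat top i).card ≤ 1 :=
    pow_le_one₀ (by norm_num) (by norm_num)
  have hp0 : 0 ≤ (0.36 : ℝ) ^ (badOthers v vhat top i).card := by positivity
  have h2 := hv i
  have h3 := hv top
  have key : ρ * v i ≤ (0.27 * v top + (1 - 0.27) * v i) * 0.36 := by
    rcases hvt with h | h
    · have := mul_le_mul_of_nonneg_right h h2
      linarith
    · have := mul_le_mul_of_nonneg_right hρ h2
      linarith
  have h4 := mul_le_mul_of_nonneg_right key hp0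
  have h5 : ρ * v i * (1 - 0.36 ^ (badOthers v vhat top i).card) ≤
      0.268 * v i * (1 - 0.36 ^ (badOthers v vhat top i).card) :=
    mul_le_mul_of_nonneg_right (mul_le_mul_of_nonneg_right (by linarith) h2) (by linarith)
  linarith

end Cases

/-! ### A bad top prediction beaten by a further candidate -/

section Blocker

variable {n : ℕ} {v vhat : Fin n → ℝ} {top i c : Fin n}

theorem le_avgReward_of_blocker_early (hv : ∀ i, 0 ≤ v i) (hi : i ≠ top)
    (hmax : ∀ j, j ≠ i → v j < v i) (hbt : IsBad stdParams v vhat top)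
    (hct : v top < v c) (hcmax : ∀ j ∈ others top i, v j ≤ v c)
    {t : ℝ} (ht : 0.64 < t) {y : Fin n → ℝ} (hy : Function.Injective y) (hyt : y top = 0.64)
    (hyi : y i = t) (hyc : y c < 0.37) : v i ≤ avgReward stdParams v vhat top y :=
  le_avgReward_of_run hv fun u => run_eq_best_of_blocker_early (P := stdParams) hy hi hmax
    (by rw [hyt, stdParams]; norm_num) (by rw [hyt, hyi]; exact ht) hbt hct hcmax hyc

theorem measureReal_coord_and {I : Set ℝ} (hI : MeasurableSet I) (hc : c ≠ top)
    {Q : Set (Fin n → ℝ)} (hQ : MeasurableSet Q)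
    (hdep : ∀ x t, Function.update x c t ∈ Q ↔ x ∈ Q) :
    (arrivalLaw top 0.64).real ({x | x c ∈ I} ∩ Q) =
      unif.real I * (arrivalLaw top 0.64).real Q := by
  rw [arrivalLaw_eq, measureReal_coord_inter _ c hI hQ hdep, timeLaw_of_ne hc]

theorem measureReal_coord {I : Set ℝ} (hI : MeasurableSet I) (hc : c ≠ top) :
    (arrivalLaw top 0.64).real {x : Fin n → ℝ | x c ∈ I} = unif.real I := by
  have := measureReal_coord_and (top := top) hI hc MeasurableSet.univ (by simp)
  rwa [Set.inter_univ, probReal_univ, mul_one] at this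

/-- A good `c` has an arrival time independent of whether the run is late: before 0.37 it always
suffices, between 0.37 and 0.64 it does in late runs. -/
theorem le_condReward_of_good_blocker (hv : ∀ i, 0 ≤ v i) (hi : i ≠ top)
    (hmax : ∀ j, j ≠ i → v j < v i) (hbt : IsBad stdParams v vhat top)
    (hbi : ¬ IsBad stdParams v vhat i) (hc : c ∈ others top i) (hct : v top < v c)
    (hcmax : ∀ j ∈ others top i, v j ≤ v c) (hbc : ¬ IsBad stdParams v vhat c)
    {t : ℝ} (ht : 0.64 < t) (hgood : GoodTime top i t) :
    (0.37 + 0.27 * 0.36 ^ (badOthers v vhat top i).card) * v i ≤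
      condReward v vhat top i t := by
  obtain ⟨hc1, hc2⟩ := mem_others.mp hc
  have hcb : c ∉ badOthers v vhat top i := fun h => hbc (mem_badOthers.mp h).2
  have hxi : ∀ x : Fin n → ℝ, Function.update x i t i = t := fun x => by simp
  have hxc : ∀ x : Fin n → ℝ, Function.update x i t c = x c := fun x =>
    Function.update_of_ne hc2 _ _
  have h := le_condReward (vhat := vhat) hv hgood
    (A := {x | x c ∈ Set.Iio 0.37})
    (B := {x | x c ∈ Set.Ioo 0.37 0.64} ∩ allAfter (badOthers v vhat top i) 0.64) (C := ∅)
    (measurable_pi_apply c measurableSet_Iio)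
    ((measurable_pi_apply c measurableSet_Ioo).inter (measurableSet_allAfter _ _))
    MeasurableSet.empty
    (by
      rw [Set.disjoint_left]
      rintro x hx ⟨hx', _⟩
      simp only [Set.mem_ofPred_eq, Set.mem_Iio, Set.mem_Ioo] at hx hx'
      linarith) (by simp) (by simp) (a := v i) (b := v i) (c := 0)
    (fun x hx hx' hxA => le_avgReward_of_blocker_early hv hi hmax hbt hct hcmax ht hx hx' (hxi x)
      (by rw [hxc]; exact hxA))
    (by
      rintro x hx hx' ⟨hx1, hx2⟩
      refine le_avgReward_of_run hv fun u => run_eq_best_of_blocker (P := stdParams) hx hi hmax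
        (by rw [hx', stdParams]; norm_num) (by rw [hx', hxi]; exact ht) hbt hbi hct hcmax
        (by rw [hx', hxc]; exact hx1.2)
        (by rw [hx']; exact (update_mem_allAfter self_notMem_badOthers x t).mpr hx2)) (by simp)
  rw [measureReal_coord measurableSet_Iio hc1, measureReal_coord_and measurableSet_Ioo hc1
    (measurableSet_allAfter _ _) (update_mem_allAfter hcb), measureReal_allAfter_badOthers,
    unif_real_Iio (by norm_num) (by norm_num),
    unif_real_Ioo (by norm_num) (by norm_num) (by norm_num)] at h
  refine le_of_eq_of_le ?_ h
  norm_num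
  ring

theorem le_condReward_of_blocker_late (hv : ∀ i, 0 ≤ v i) (hinj : Function.Injective v)
    (hi : i ≠ top) (hmax : ∀ j, j ≠ i → v j < v i) (hbt : IsBad stdParams v vhat top)
    (hbi : ¬ IsBad stdParams v vhat i) (hc : c ∈ others top i)
    (hgood : ∀ j ∈ (others top i).erase c, ¬ IsBad stdParams v vhat j) {a t : ℝ} (ha : 0 ≤ a)
    (ha' : a ≤ 0.64) (ht : 0.64 < t) (ht' : t ≤ 1) (htgood : GoodTime top i t)
    (hearly : ∀ y, Function.Injective y → y top = 0.64 → y i = t → y c < a →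
      v i ≤ avgReward stdParams v vhat top y) :
    a * v i + 0.4672 * v i * ((1 - t) * (2 - t)) ≤ condReward v vhat top i t := by
  classical
  obtain ⟨hc1, hc2⟩ := mem_others.mp hc
  have hxi : ∀ x : Fin n → ℝ, Function.update x i t i = t := fun x => by simp
  have hxc : ∀ x : Fin n → ℝ, Function.update x i t c = x c := fun x =>
    Function.update_of_ne hc2 _ _
  set bad := IsBad stdParams v vhat with hbad
  set s := (others top i).erase c with hs
  have hsi : i ∉ s := fun h => self_notMem_others (Finset.mem_of_mem_erase h)
  have hsc : c ∉ s := Finset.notMem_erase c _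
  -- `True` switches off the requirement of a bad arrival.
  set Q := noRecord v s 0.64 t ∩ {x | True ∨ x ∈ badBefore bad s t} with hQ
  have hQm : MeasurableSet Q := (measurableSet_noRecord _ _ _ _).inter
    ((MeasurableSet.const _).union (measurableSet_badBefore _ _ _))
  have h := le_condReward (vhat := vhat) hv htgood
    (A := {x | x c ∈ Set.Iio a}) (B := {x | x c ∈ Set.Ioi t} ∩ Q) (C := ∅)
    (measurable_pi_apply c measurableSet_Iio)
    ((measurable_pi_apply c measurableSet_Ioi).inter hQm) MeasurableSet.empty
    (by
      rw [Set.disjoint_left]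
      rintro x hx ⟨hx', _⟩
      simp only [Set.mem_ofPred_eq, Set.mem_Iio, Set.mem_Ioi] at hx hx'
      linarith) (by simp) (by simp) (a := v i) (b := (1 - 0.27) * v i) (c := 0)
    (fun x hx hx' hxA => hearly _ hx hx' (hxi x) (by rw [hxc]; exact hxA))
    (by
      rintro x hx hx' ⟨hx1, hx2, _⟩
      refine le_avgReward_of_ge hv (by norm_num) (by norm_num) fun u hu =>
        run_eq_best_of_blocker_late (P := stdParams) (c := c) hx hi hmax
          (by rw [hx', stdParams]; norm_num) (by rw [hx', hxi]; exact ht) hbt hbi hgood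
          (by rw [hxi, hxc]; exact hx1) ?_ hu
      rw [hx', hxi]
      exact (update_mem_noRecord hsi x t).mpr hx2) (by simp)
  have hE := le_measureReal_noRecord (timeLaw top 0.64) v bad True s
    (fun j hj => timeLaw_of_mem_others (Finset.mem_of_mem_erase hj)) hinj (a := 0.64) (b := t)
    (by norm_num) ht.le (by linarith) ht'
  rw [if_pos trivial, ← arrivalLaw_eq, zero_mul, sub_zero, mul_one] at hE
  rw [measureReal_coord measurableSet_Iio hc1, measureReal_coord_and measurableSet_Ioi hc1 hQm
    (fun x r => and_congr (update_mem_noRecord hsc x r)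
      (or_congr Iff.rfl (update_mem_badBefore hsc x r))),
    unif_real_Iio ha (by linarith), unif_real_Ioi (by linarith) ht'] at h
  -- The tangent bound 1/t ≥ 2-t at t = 1 keeps the integrand polynomial; 0.4672 = 0.73·0.64.
  have hle : 0.64 * (2 - t) ≤ 0.64 / t := by
    rw [le_div_iff₀ (by linarith)]
    have := sq_nonneg (1 - t)
    linarith
  have h3 := mul_le_mul_of_nonneg_left (hle.trans hE)
    (mul_nonneg (hv i) (sub_nonneg.mpr ht'))
  rw [← hQ] at h3
  linarith

/-- For k = 0 every run is late, so any `c` before 0.64 works: 0.64·0.36 + 0.4672·0.080352 > 0.267.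
For k = 1 a bad `c` gives 0.37·0.27 + 0.37·0.36 + 0.4672·0.080352 > 0.270, a good one 0.37·0.27 +
0.4672·0.36 > 0.268. For k ≥ 2 an early `c` suffices: 0.5032·0.27 + 0.37·0.36 > 0.269. -/
theorem le_expectedReward_of_blocker (hv : ∀ i, 0 ≤ v i) (hinj : Function.Injective v)
    (hi : i ≠ top) (hmax : ∀ j, j ≠ i → v j < v i) (hbt : IsBad stdParams v vhat top)
    (hbi : ¬ IsBad stdParams v vhat i) (hc : c ∈ others top i) (hct : v top < v c)
    (hcmax : ∀ j ∈ others top i, v j ≤ v c) :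
    0.2659 * v i ≤ expectedReward stdParams 0.64 v vhat top := by
  have hnonneg : ∀ t, 0 ≤ condReward v vhat top i t := fun t =>
    integral_nonneg fun x => avgReward_nonneg stdParams vhat top hv _
  have hvi := hv i
  have hbefore : ∀ t, 0.37 < t → t < 0.64 → GoodTime top i t →
      0.37 * (∑ m ∈ Finset.range (badOthers v vhat top i).card, (1 - t) ^ m) * v i ≤
        condReward v vhat top i t := by
    intro t ht ht' hg
    have := le_condReward_before hv hinj hi hmax ht ht' hg (rewardIfLate_zero (vhat := vhat) hv t)
    linarith
  have hearly : ∀ {t}, 0.64 < t → ∀ y, Function.Injective y → y top = 0.64 → y i = t →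
      y c < 0.37 → v i ≤ avgReward stdParams v vhat top y :=
    fun ht y hy hyt hyi => le_avgReward_of_blocker_early hv hi hmax hbt hct hcmax ht hy hyt hyi
  obtain hk | hk | hk : (badOthers v vhat top i).card = 0 ∨ (badOthers v vhat top i).card = 1 ∨
      2 ≤ (badOthers v vhat top i).card := by omega
  · have hempty := Finset.card_eq_zero.mp hk
    have hgood : ∀ j ∈ others top i, ¬ IsBad stdParams v vhat j := fun j hj hb => by
      have := mem_badOthers.mpr ⟨mem_others.mp hj, hb⟩
      simp [hempty] at this
    have h := le_expectedReward_of_condReward (vhat := vhat) hv hi (g0 := 0) (g1 := 0)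
      (c0 := 0.64 * v i) (c1 := 0.4672 * v i) (fun t _ _ _ => hnonneg t)
      (fun t _ _ _ => hnonneg t) (fun t ht ht' hg => le_condReward_of_blocker_late hv hinj hi
        hmax hbt hbi hc (fun j hj => hgood j (Finset.mem_of_mem_erase hj)) (by norm_num) le_rfl
        ht ht' hg (fun y hy hyt hyi hyc => le_avgReward_of_run hv fun u =>
          run_eq_best_of_blocker (P := stdParams) hy hi hmax
            (by rw [hyt, stdParams]; norm_num) (by rw [hyt, hyi]; exact ht) hbt hbi hct hcmax
            (by rw [hyt]; exact hyc) (by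
              change y ∈ allAfter (badOthers v vhat top i) _
              simp [hempty, allAfter])))
    linarith
  · rw [hk] at hbefore
    by_cases hbc : IsBad stdParams v vhat c
    · have hcb : c ∈ badOthers v vhat top i := mem_badOthers.mpr ⟨mem_others.mp hc, hbc⟩
      obtain ⟨d, hd⟩ := Finset.card_eq_one.mp hk
      rw [hd, Finset.mem_singleton] at hcb
      have hgood : ∀ j ∈ (others top i).erase c, ¬ IsBad stdParams v vhat j := fun j hj hb => by
        have := mem_badOthers.mpr ⟨mem_others.mp (Finset.mem_of_mem_erase hj), hb⟩
        rw [hd, Finset.mem_singleton, ← hcb] at this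
        exact (Finset.ne_of_mem_erase hj) this
      have h := le_expectedReward_of_condReward (vhat := vhat) hv hi (g0 := 0)
        (g1 := 0.37 * v i) (c0 := 0.37 * v i) (c1 := 0.4672 * v i) (fun t _ _ _ => hnonneg t)
        (fun t ht ht' hg => by simpa using hbefore t ht ht' hg)
        (fun t ht ht' hg => le_condReward_of_blocker_late hv hinj hi
          hmax hbt hbi hc hgood (by norm_num) (by norm_num) ht ht' hg (hearly ht))
      linarith
    · have h := le_expectedReward_of_condReward (vhat := vhat) hv hi (g0 := 0)
        (g1 := 0.37 * v i) (c0 := (0.37 + 0.27 * 0.36) * v i) (c1 := 0)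
        (fun t _ _ _ => hnonneg t)
        (fun t ht ht' hg => by simpa using hbefore t ht ht' hg)
        (fun t ht ht' hg => by
          have := le_condReward_of_good_blocker hv hi hmax hbt hbi hc hct hcmax hbc ht hg
          rw [hk, pow_one] at this
          linarith)
      linarith
  -- The first two terms of the geometric sum give 0.37·(1 + 0.36) = 0.5032.
  · have h := le_expectedReward_of_condReward (vhat := vhat) hv hi (g0 := 0)
      (g1 := 0.5032 * v i) (c0 := 0.37 * v i) (c1 := 0)
      (fun t _ _ _ => hnonneg t)
      (fun t ht ht' hg => by
        refine le_trans (mul_le_mul_of_nonneg_right ?_ hvi) (hbefore t ht ht' hg)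
        have := Finset.sum_le_sum_of_subset_of_nonneg (f := fun m => (1 - t) ^ m)
          (Finset.range_subset_range.mpr hk) (fun m _ _ => pow_nonneg (by linarith) m)
        simp only [Finset.sum_range_succ, Finset.sum_range_zero, pow_zero, pow_one] at this
        linarith)
      (fun t ht ht' hg => by
        have := le_condReward (vhat := vhat) hv hg
          (A := {x | x c ∈ Set.Iio 0.37}) (B := ∅) (C := ∅)
          (measurable_pi_apply c measurableSet_Iio) MeasurableSet.empty MeasurableSet.empty
          (by simp) (by simp) (by simp) (a := v i) (b := 0) (c := 0)
          (fun x hx hx' hxA => hearly ht _ hx hx' (by simp)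
            (by rw [Function.update_of_ne (mem_others.mp hc).2]; exact hxA)) (by simp) (by simp)
        rw [measureReal_coord measurableSet_Iio (mem_others.mp hc).1,
          unif_real_Iio (by norm_num) (by norm_num)] at this
        linarith)
    linarith

end Blocker

/-! ### Prediction errors and value ratios -/

section Ratio

theorem predError_nonneg (v vhat : ℝ) : 0 ≤ predError v vhat := by
  unfold predError
  split_ifs
  · exact le_rfl
  · exact zero_le_one
  · exact abs_nonneg _

theorem ratio_nonpos {e : ℝ} (he : 1 ≤ e) : (1 - e) / (1 + e) ≤ 0 :=
  div_nonpos_of_nonpos_of_nonneg (by linarith) (by linarith)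

/-- If the prediction for a candidate of value `w` is at least as high as the one for a candidate
of value `z`, and both errors are at most `e`, then `w` is not much lower than `z`. -/
theorem ratio_mul_le {w z what zhat e : ℝ} (hw : 0 ≤ w) (hz : 0 ≤ z) (he : 0 ≤ e)
    (hle : zhat ≤ what) (hew : predError w what ≤ e) (hez : predError z zhat ≤ e) :
    (1 - e) / (1 + e) * z ≤ w := by
  by_cases he1 : 1 ≤ e
  · exact (mul_nonpos_of_nonpos_of_nonneg (ratio_nonpos he1) hz).trans hw
  -- From here on, `e < 1` excludes a nonzero prediction for a candidate of value zero.
  rw [not_le] at he1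
  have hwhat : what ≤ (1 + e) * w := by
    unfold predError at hew
    split_ifs at hew with h1 h2
    · simp [h1, h2]
    · linarith
    · have hw' : 0 < w := lt_of_le_of_ne hw (Ne.symm h1)
      have := (abs_le.mp hew).1
      rw [← div_le_iff₀ hw']
      linarith
  have hzhat : (1 - e) * z ≤ zhat := by
    unfold predError at hez
    split_ifs at hez with h1 h2
    · simp [h1, h2]
    · linarith
    · have hz' : 0 < z := lt_of_le_of_ne hz (Ne.symm h1)
      have := (abs_le.mp hez).2
      rw [← le_div_iff₀ hz']
      linarith
  rw [div_mul_eq_mul_div, div_le_iff₀ (by linarith)]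
  linarith

theorem ratio_anti {a b : ℝ} (ha : 0 ≤ a) (hab : a ≤ b) :
    (1 - b) / (1 + b) ≤ (1 - a) / (1 + a) := by
  rw [div_le_div_iff₀ (by linarith) (by linarith)]
  nlinarith

theorem predError_le_maxError {n : ℕ} (v vhat : Fin n → ℝ) (i : Fin n) :
    predError (v i) (vhat i) ≤ maxError v vhat :=
  le_ciSup (f := fun i => predError (v i) (vhat i)) (Set.finite_range _).bddAbove i

end Ratio


/-! ### Combining the cases -/

theorem max_mul_bestValue_le_expectedReward {n : ℕ} {v vhat : Fin n → ℝ} (hv : ∀ i, 0 ≤ v i)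
    (hinj : Function.Injective v) {top : Fin n} (htop : ∀ i, vhat i ≤ vhat top) :
    max (0.262 : ℝ) ((1 - maxError v vhat) / (1 + maxError v vhat)) * bestValue v ≤
      expectedReward stdParams 0.64 v vhat top := by
  have : Nonempty (Fin n) := ⟨top⟩
  obtain ⟨i, hi⟩ := Finite.exists_max v
  have hbest : bestValue v = v i := le_antisymm (ciSup_le hi) (le_bestValue v i)
  have hmax : ∀ j, j ≠ i → v j < v i := fun j hj => lt_of_le_of_ne (hi j) fun h => hj (hinj h)
  have hvi := hv i
  have he := predError_le_maxError v vhat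
  have he0 : 0 ≤ maxError v vhat := (predError_nonneg _ _).trans (he i)
  have hratio := ratio_mul_le (hv top) hvi he0 (htop i) (he top) (he i)
  have hθ : (1 - (0.58 : ℝ)) / (1 + 0.58) = 42 / 158 := by norm_num
  rw [hbest]
  set ρ := max (0.262 : ℝ) ((1 - maxError v vhat) / (1 + maxError v vhat)) with hρ
  by_cases hbad : ∃ b, IsBad stdParams v vhat b
  · have hρ' : ρ ≤ 42 / 158 := by
      obtain ⟨b, hb⟩ := hbad
      refine max_le (by norm_num) ?_
      rw [← hθ]
      exact ratio_anti (by norm_num) ((le_of_lt hb).trans (he b))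
    have hred : ∀ {r}, 42 / 158 ≤ r → r * v i ≤ expectedReward stdParams 0.64 v vhat top →
        ρ * v i ≤ expectedReward stdParams 0.64 v vhat top := fun hr h =>
      (mul_le_mul_of_nonneg_right (hρ'.trans hr) hvi).trans h
    by_cases hit : i = top
    · subst hit
      exact hred (by norm_num) (le_expectedReward_of_top_best hv hinj hmax)
    by_cases hbi : IsBad stdParams v vhat i
    · exact hred (by norm_num) (le_expectedReward_of_isBad_best hv hinj hit hmax hbi)
    by_cases hbt : IsBad stdParams v vhat top
    · by_cases hsec : ∀ j ∈ others top i, v j ≤ v top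
      · refine le_expectedReward_of_top_second hv hinj hit hmax hbi hbt hsec hρ' ?_
        rcases max_cases (0.262 : ℝ) ((1 - maxError v vhat) / (1 + maxError v vhat)) with h | h
        · exact Or.inl h.1.le
        · exact Or.inr (by rw [hρ, h.1]; exact hratio)
      · push Not at hsec
        obtain ⟨j, hj, hjt⟩ := hsec
        obtain ⟨c, hc, hcmax⟩ := Finset.exists_max_image (others top i) v ⟨j, hj⟩
        exact hred (by norm_num) (le_expectedReward_of_blocker hv hinj hit hmax hbt hbi hc
          (hjt.trans_le (hcmax j hj)) hcmax)
    -- Both candidates are good, so the comparison works with the error bound θ even though the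
    -- largest error exceeds it.
    · have hvt := ratio_mul_le (hv top) hvi (by rw [stdParams]; norm_num) (htop i) (not_lt.mp hbt) (not_lt.mp hbi)
      rw [show stdParams.θ = 0.58 from rfl, hθ] at hvt
      exact hred le_rfl (le_expectedReward_of_good hv hinj hit hmax hbi hbt hvt)
  · push Not at hbad
    have hvt := ratio_mul_le (hv top) hvi (by rw [stdParams]; norm_num) (htop i) (not_lt.mp (hbad top))
      (not_lt.mp (hbad i))
    rw [show stdParams.θ = 0.58 from rfl, hθ] at hvt
    -- The threshold handles the constant 0.262, and the actual largest error handles the ratio.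
    have hle : ρ * v i ≤ v top := by
      rcases max_cases (0.262 : ℝ) ((1 - maxError v vhat) / (1 + maxError v vhat)) with h | h
      · rw [hρ, h.1]; linarith
      · rw [hρ, h.1]; exact hratio
    refine hle.trans ?_
    rw [expectedReward_eq stdParams vhat top hv]
    have := sum_le_integral_of_le_on (ν := arrivalLaw top 0.64)
      (integrable_avgReward_comp stdParams vhat top hv measurable_id)
      (fun x => avgReward_nonneg stdParams vhat top hv _)
      (A := Set.univ) (B := ∅) (C := ∅) MeasurableSet.univ MeasurableSet.empty MeasurableSet.empty
      (by simp) (by simp) (by simp) (a := v top) (b := 0) (c := 0)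
      (by
        filter_upwards [ae_injective top 0.64] with x hx _
        exact le_avgReward_of_run hv fun u =>
          run_eq_top_of_prediction hx fun b hb => absurd hb (hbad b))
      (by simp) (by simp)
    rw [probReal_univ] at this
    simp only [id] at this
    linarith

end COSP

theorem theorem1 (n : ℕ) (v vhat : Fin n → ℝ)
    (hv : ∀ i, 0 ≤ v i) (hvhat : ∀ i, 0 ≤ vhat i) (hinj : Function.Injective v)
    (top : Fin n) (htop : ∀ i, vhat i ≤ vhat top) :
    max (0.262 : ℝ) ((1 - COSP.maxError v vhat) / (1 + COSP.maxError v vhat)) *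
        COSP.bestValue v ≤
      COSP.expectedReward { θ := 0.58, τ := 0.37, γ := 0.27, δ := 0.46 } 0.64 v vhat top :=
  COSP.max_mul_bestValue_le_expectedReward hv hinj htop
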